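/- **Setting.** Let $r:\mathbb{Z}_{\ge 0}\to\mathbb{Z}_{>0}$ satisfy $r(0)=1$ and $r(m)\le r(m+1)\le r(m)+1$ for all $m\ge 0$. Let the values $X_1,X_2,\dots$ of the candidates be i.i.d. real random variables with a continuous (atomless) distribution. Candidates are examined one by one; if $m$ candidates have been accepted so far, the next candidate is accepted if and only if her value exceeds the $r(m)$-th largest of the $m$ values already accepted (she is always accepted if $r(m)=m+1$). Let $M_n$ be the number of candidates accepted among the first $n$. Let $0<\alpha\le 1$ and assume $$\sum_{m=1}^\infty\Bigl|\frac1{r(m)}-\frac1{\alpha m}\Bigr|<\infty$$ (this holds, for example, if $r(m)=\alpha m+O(1)$). Let $\rho=\sum_{m\ge1}\bigl(\frac1{r(m)}-\frac1{\alpha m}\bigr)$, let $\gamma$ be Euler's constant, and let $r_*=\inf\{r(k): k\ge1,\ r(k)=r(k-1)\}$ be the first repeated value of $r$ (with $r_*=\infty$ if no value is repeated). **Theorem.** There is an a.s. positive random variable $W$ such that $M_n/n^\alpha\to W$ a.s., and $W$ has the same distribution as $e^{(\alpha-1)\gamma-\alpha\rho-\alpha}\,e^{-\alpha Z}$, where $$Z=\sum_{k\ge1:\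 r(k)=r(k-1)}\frac{E_k-1}{r(k)}$$ with $E_1,E_2,\dots$ i.i.d. $\mathrm{Exp}(1)$, the series being a.s. convergent. Moreover: (i) For every complex $s$ with $\operatorname{Re}s>-r_*/\alpha$, $W^s$ is integrable and $$\frac{\mathbb{E}M_n^s}{n^{\alpha s}}\longrightarrow \mathbb{E}W^s\qquad(n\to\infty).$$ The limit $\mathbb{E}W^s$ is an analytic function of $s$ in this half-plane, and $$\mathbb{E}W^s=\frac{\Gamma(s+1)}{\Gamma(s\alpha+2)}\prod_{k=1}^\infty\frac{1+s/k}{1+s\alpha/r(k)}$$ for every $s$ in the half-plane such that $s\ne -k$ and $s\alpha\neq -r(k)$ for all $k\ge1$, where the product is (unconditionally) convergent; at the remaining points of the half-plane the right-hand side is interpreted by continuity. (ii) For every real $s\le -r_*/\alpha$, $\mathbb{E}M_n^s/n^{\alpha s}\to\infty$ as $n\to\infty$. -/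

import Mathlib

open MeasureTheory ProbabilityTheory Filter Topology

noncomputable section

namespace Hiring

/-- The admissible rank functions `r`: `r 0 = 1` and `r m ≤ r (m + 1) ≤ r m + 1` for all `m`. -/
def IsRankFunction (r : ℕ → ℕ) : Prop :=
  r 0 = 1 ∧ ∀ m, r m ≤ r (m + 1) ∧ r (m + 1) ≤ r m + 1

/-- The threshold for the next candidate, when `A` is the set of the candidates accepted so far and
`x i` is the value of candidate `i`. With `m = #A`, it is the `r m`-th largest of the values of the
accepted candidates, and `⊥` (every candidate is accepted) if `r m > m`. -/
def threshold (r : ℕ → ℕ) (x : ℕ → ℝ) (A : Finset ℕ) : WithBot ℝ :=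
  (((A.val.map x).sort (· ≥ ·)).map (fun y : ℝ => (y : WithBot ℝ))).getD (r A.card - 1) ⊥

open Classical in
/-- The set of accepted candidates among the first `n`. Candidates are numbered from `0`, so the
first `n` candidates are `0, …, n - 1`. -/
def accepted (r : ℕ → ℕ) (x : ℕ → ℝ) : ℕ → Finset ℕ
  | 0 => ∅
  | n + 1 =>
    if threshold r x (accepted r x n) < (x n : WithBot ℝ) then insert n (accepted r x n)
    else accepted r x n

/-- `M_n`, the number of accepted candidates among the first `n`. -/
def numAccepted (r : ℕ → ℕ) (x : ℕ → ℝ) (n : ℕ) : ℕ := (accepted r x n).card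

/-- The smallest repeated value `inf {r k : k ≥ 1, r k = r (k - 1)}` of `r`; it is `⊤` if no value
is repeated. -/
def firstRepeated (r : ℕ → ℕ) : EReal :=
  ⨅ k ∈ {k : ℕ | 1 ≤ k ∧ r k = r (k - 1)}, ((r k : ℝ) : EReal)

/-- The roughly linear rank functions: `∑_{m ≥ 1} |1 / r m - 1 / (α m)| < ∞`. -/
def RoughlyLinear (r : ℕ → ℕ) (α : ℝ) : Prop :=
  Summable fun m : ℕ => |1 / (r (m + 1) : ℝ) - 1 / (α * ((m : ℝ) + 1))|

/-- `ρ = ∑_{m ≥ 1} (1 / r m - 1 / (α m))`. -/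
def rho (r : ℕ → ℕ) (α : ℝ) : ℝ :=
  ∑' m : ℕ, (1 / (r (m + 1) : ℝ) - 1 / (α * ((m : ℝ) + 1)))

/-- `∑_{1 ≤ k ≤ m, r k = r (k - 1)} (e k - 1) / r k`, the partial sums of the series `Z`. -/
def zPartial (r : ℕ → ℕ) (e : ℕ → ℝ) (m : ℕ) : ℝ :=
  ∑ k ∈ Finset.Icc 1 m, if r k = r (k - 1) then (e k - 1) / (r k : ℝ) else 0

/-- The law of a sequence of independent `Exp(1)` random variables. -/
def iidExp : Measure (ℕ → ℝ) := Measure.infinitePi fun _ : ℕ => expMeasure 1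

/-- The open half-plane `Re s > - r_* / α`, where `r_*` is the smallest repeated value of `r`. -/
def halfPlane (r : ℕ → ℕ) (α : ℝ) : Set ℂ :=
  {s : ℂ | -firstRepeated r / (α : EReal) < (s.re : EReal)}

end Hiring

end

/-! Every earlier candidate whose value exceeds the current threshold has been accepted, so
candidate `n` is accepted exactly when her relative rank among all earlier candidates is below `r
m`, where `m` is the current number of acceptances (`threshold_accepted_lt_iff`). Relative ranks of
i.i.d. atomless values are independent and uniform, hence `M` steps from `m` to `m + 1` with
conditional probability `r m / (n + 1)` (`isHiringChain_hires`).

For such a chain the functions `g m = ∏_{a ≤ k < m} (1 + l / r k)` act as eigenfunctions: `g (m + 1)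
- g m = (l / r m) * g m`, so a step multiplies the conditional mean by `1 + l / (n + 1)`. If `r k =
k + 1` for `k < a`, then `M_a = a` a.s. and `E g (M_n) = ∏_{a ≤ k < n} (1 + l / (k + 1))` exactly
(`integral_linProd`). With `l = α s`, rough linearity gives `g m ~ C m ^ s`, while the right side is
`~ D n ^ (α s)`; passing to the limit, `E W ^ s * C = D` (`integral_cpow_mul_eq`), and everything
about the law of `W` is read off from this identity.

For `l = 1` one gets a nonnegative martingale, whose convergence makes `M_n / n ^ α` converge; Fatou
with a bounded negative moment makes the limit positive. Starting the product at a suitable `a`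
discards deterministic factors that could vanish or be negative, which yields moment bounds for all
`Re s > -r_* / α`; slightly larger exponents give uniform integrability. With products from `1`, `D`
is `1 / Γ(α s + 2)`, and `C` is compared with the Gauss product of `Γ(s + 1)`. On the imaginary axis
the identity gives the characteristic function of `log W`, which is matched with that of `Z`: the
repeated indices are all indices minus one index for each new value. Finally, as `α s` decreases to
`-r_*`, the factor at `k = r_*` sends `C` to `0` while `D` stays bounded below, so the moments of
`W` explode. -/

namespace Hiring

/-! ### Acceptance is decided by the relative rank. -/

/-- The number of indices `i < n` with `x n ≤ x i`. -/
noncomputable def relRank (x : ℕ → ℝ) (n : ℕ) : ℕ := ((Finset.range n).filter fun i => x n ≤ x i).card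

/-- The counting process obtained by accepting candidate `n` when `ρ n < r m`, where `m` is the
current number of accepted candidates. -/
def hires (r : ℕ → ℕ) (ρ : ℕ → ℕ) : ℕ → ℕ
  | 0 => 0
  | n + 1 => if ρ n < r (hires r ρ n) then hires r ρ n + 1 else hires r ρ n

lemma IsRankFunction.monotone {r : ℕ → ℕ} (hr : IsRankFunction r) : Monotone r :=
  monotone_nat_of_le_succ fun m => (hr.2 m).1

lemma IsRankFunction.one_le {r : ℕ → ℕ} (hr : IsRankFunction r) (m : ℕ) : 1 ≤ r m :=
  hr.1 ▸ hr.monotone (Nat.zero_le m)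

lemma IsRankFunction.le_succ {r : ℕ → ℕ} (hr : IsRankFunction r) (m : ℕ) : r m ≤ m + 1 := by
  induction m with
  | zero => simp [hr.1]
  | succ m ih => exact (hr.2 m).2.trans (by omega)

/-- In a decreasing list the entries that are at least `y` form an initial segment, so position `j`
lies below `y` exactly when that segment has length at most `j`. The default `⊥` handles lists too
short to have position `j`. -/
lemma getD_map_lt_iff (l : List ℝ) (hl : l.Pairwise (· ≥ ·)) (j : ℕ) (y : ℝ) :
    (l.map (fun z : ℝ => (z : WithBot ℝ))).getD j ⊥ < (y : WithBot ℝ) ↔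
      l.countP (fun z => decide (y ≤ z)) ≤ j := by
  induction l generalizing j with
  | nil => simp
  | cons a l ih =>
    rw [List.pairwise_cons] at hl
    have hzero : a < y → l.countP (fun z => decide (y ≤ z)) = 0 := by
      intro h
      rw [List.countP_eq_zero]
      intro z hz
      simpa using (hl.1 z hz).trans_lt h
    cases j with
    | zero =>
      rw [List.countP_cons]
      by_cases h : y ≤ a
      · simp [h]
      · simp [h, hzero (not_le.1 h), not_le.1 h]
    | succ j =>
      rw [List.map_cons, List.getD_cons_succ, ih hl.2, List.countP_cons]
      by_cases h : y ≤ a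
      · simp [h]
      · simp [h, hzero (not_le.1 h)]

lemma threshold_lt_iff (r : ℕ → ℕ) (hr : ∀ m, 1 ≤ r m) (x : ℕ → ℝ) (A : Finset ℕ) (y : ℝ) :
    threshold r x A < (y : WithBot ℝ) ↔ (A.filter fun i => y ≤ x i).card < r A.card := by
  rw [threshold, getD_map_lt_iff _ (Multiset.pairwise_sort _ _),
    ← Multiset.coe_countP, Multiset.sort_eq, Multiset.countP_map]
  have h := hr A.card
  rw [← Finset.filter_val, Finset.card_val]
  omega

/-- Every candidate above the current threshold has been accepted. -/
lemma mem_accepted_of_threshold_lt (r : ℕ → ℕ) (hr : IsRankFunction r) (x : ℕ → ℝ) (n : ℕ) :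
    accepted r x n ⊆ Finset.range n ∧
      ∀ i < n, threshold r x (accepted r x n) < (x i : WithBot ℝ) → i ∈ accepted r x n := by
  induction n with
  | zero => simp [accepted]
  | succ n ih =>
    obtain ⟨ih1, ih2⟩ := ih
    have hn : n ∉ accepted r x n := fun h => by simpa using ih1 h
    rw [accepted]
    split_ifs with h
    · refine ⟨Finset.insert_subset (by simp) (ih1.trans (Finset.range_subset_range.2 n.le_succ)), ?_⟩
      intro i hi hlt
      rcases Nat.lt_succ_iff_lt_or_eq.1 hi with hi | rfl
      · refine Finset.mem_insert_of_mem (ih2 i hi ?_)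
        -- If `x i ≤ x n`, accepting `n` raises the count for `x i` by one and `r` by at most one,
        -- so `x i` was already above the old threshold. Otherwise `x i` exceeds `x n`, which itself
        -- passed.
        rcases le_or_gt (x i) (x n) with hxy | hxy
        · rw [threshold_lt_iff r hr.one_le] at hlt ⊢
          rw [Finset.filter_insert, if_pos hxy, Finset.card_insert_of_notMem hn,
            Finset.card_insert_of_notMem (by simp [hn])] at hlt
          have := (hr.2 (accepted r x n).card).2
          omega
        · exact h.trans (by exact_mod_cast hxy)
      · exact Finset.mem_insert_self _ _
    · refine ⟨ih1.trans (Finset.range_subset_range.2 n.le_succ), ?_⟩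
      intro i hi hlt
      rcases Nat.lt_succ_iff_lt_or_eq.1 hi with hi | rfl
      · exact ih2 i hi hlt
      · exact absurd hlt h

/-- If `x n` beats the threshold, so does every earlier value that is at least `x n`; those
candidates are all accepted, and counting among the accepted or among everybody is the same. The
converse holds because the accepted are a subset. -/
lemma threshold_accepted_lt_iff (r : ℕ → ℕ) (hr : IsRankFunction r) (x : ℕ → ℝ) (n : ℕ) :
    threshold r x (accepted r x n) < (x n : WithBot ℝ) ↔
      relRank x n < r (accepted r x n).card := by
  obtain ⟨h1, h2⟩ := mem_accepted_of_threshold_lt r hr x n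
  constructor
  · intro h
    have h' := (threshold_lt_iff r hr.one_le x _ _).1 h
    refine lt_of_le_of_lt (Finset.card_le_card ?_) h'
    intro i hi
    rw [Finset.mem_filter] at hi ⊢
    exact ⟨h2 i (Finset.mem_range.1 hi.1) (h.trans_le (by exact_mod_cast hi.2)), hi.2⟩
  · intro h
    rw [threshold_lt_iff r hr.one_le]
    exact lt_of_le_of_lt (Finset.card_le_card (Finset.filter_subset_filter _ h1)) h

lemma numAccepted_eq_hires (r : ℕ → ℕ) (hr : IsRankFunction r) (x : ℕ → ℝ) (n : ℕ) :
    numAccepted r x n = hires r (relRank x) n := by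
  induction n with
  | zero => rfl
  | succ n ih =>
    have hn : n ∉ accepted r x n := fun h => by
      simpa using (mem_accepted_of_threshold_lt r hr x n).1 h
    rw [numAccepted, accepted, hires, ← ih, numAccepted]
    simp only [threshold_accepted_lt_iff r hr x n]
    split_ifs
    · exact Finset.card_insert_of_notMem hn
    · rfl

lemma hires_congr (r : ℕ → ℕ) {ρ ρ' : ℕ → ℕ} {n : ℕ} (h : ∀ k < n, ρ k = ρ' k) :
    hires r ρ n = hires r ρ' n := by
  induction n with
  | zero => rfl
  | succ n ih => rw [hires, hires, ih fun k hk => h k (by omega), h n n.lt_succ_self]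

lemma measurable_hires (r : ℕ → ℕ) (n : ℕ) : Measurable fun ρ : ℕ → ℕ => hires r ρ n := by
  induction n with
  | zero => exact measurable_const
  | succ n ih =>
    simp only [hires]
    exact Measurable.ite
      (measurableSet_lt (measurable_pi_apply n) (measurable_from_top.comp ih))
      (measurable_from_top.comp (g := fun m : ℕ => m + 1) ih) ih

lemma relRank_congr {x y : ℕ → ℝ} {n : ℕ} (h : ∀ i < n, x n ≤ x i ↔ y n ≤ y i) :
    relRank x n = relRank y n := by
  rw [relRank, relRank]
  congr 1
  exact Finset.filter_congr fun i hi => h i (Finset.mem_range.1 hi)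

lemma measurable_relRank (n : ℕ) : Measurable fun x : ℕ → ℝ => relRank x n := by
  simp only [relRank, Finset.card_filter]
  exact Finset.measurable_sum _ fun i _ => Measurable.ite
    (measurableSet_le (measurable_pi_apply n) (measurable_pi_apply i)) measurable_const
    measurable_const

/-! ### Rearrangements of the first values and their ranks. -/

/-- The relative ranks of the first `n` candidates. -/
noncomputable def ranksBefore (n : ℕ) (x : ℕ → ℝ) : ℕ → ℕ :=
  fun k => if k < n then relRank x k else 0

lemma measurable_ranksBefore (n : ℕ) : Measurable (ranksBefore n) := by
  refine measurable_pi_lambda _ fun k => ?_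
  unfold ranksBefore
  split_ifs
  · exact measurable_relRank k
  · exact measurable_const

lemma ranksBefore_congr {x y : ℕ → ℝ} {n : ℕ}
    (h : ∀ k < n, ∀ i < n, x k ≤ x i ↔ y k ≤ y i) : ranksBefore n x = ranksBefore n y := by
  funext k
  unfold ranksBefore
  split_ifs with hk
  · exact relRank_congr fun i hi => h k hk i (hi.trans hk)
  · rfl

/-- A permutation of `Fin n`, extended by the identity to a permutation of `ℕ`. -/
def extPerm {n : ℕ} (τ : Equiv.Perm (Fin n)) : Equiv.Perm ℕ :=
  τ.extendDomain (Fin.equivSubtype : Fin n ≃ {i // i < n})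

lemma extPerm_apply_of_lt {n : ℕ} (τ : Equiv.Perm (Fin n)) {k : ℕ} (h : k < n) :
    extPerm τ k = τ ⟨k, h⟩ := by
  rw [extPerm, Equiv.Perm.extendDomain_apply_subtype τ Fin.equivSubtype (b := k) h]
  rfl

lemma extPerm_apply_of_le {n : ℕ} (τ : Equiv.Perm (Fin n)) {k : ℕ} (h : n ≤ k) :
    extPerm τ k = k :=
  Equiv.Perm.extendDomain_apply_not_subtype _ _ (by omega)

lemma relRank_comp_extPerm {n : ℕ} (τ : Equiv.Perm (Fin n)) (x : ℕ → ℝ) :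
    relRank (x ∘ extPerm τ) n = relRank x n := by
  rw [relRank, relRank]
  refine Finset.card_bij (fun i _ => extPerm τ i) ?_ (fun _ _ _ _ h => (extPerm τ).injective h) ?_
  · intro i hi
    simp only [Finset.mem_filter, Finset.mem_range, Function.comp_apply,
      extPerm_apply_of_le τ le_rfl] at hi ⊢
    refine ⟨?_, hi.2⟩
    rw [extPerm_apply_of_lt τ hi.1]
    exact (τ _).2
  · intro i hi
    simp only [Finset.mem_filter, Finset.mem_range, Function.comp_apply,
      extPerm_apply_of_le τ le_rfl] at hi ⊢
    have h : extPerm τ (τ.symm ⟨i, hi.1⟩) = i := by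
      rw [extPerm_apply_of_lt τ (τ.symm ⟨i, hi.1⟩).2]
      simp
    exact ⟨τ.symm ⟨i, hi.1⟩, ⟨(τ.symm ⟨i, hi.1⟩).2, by rw [h]; exact hi.2⟩, h⟩

/-- The orders of the first `n` values: the number of the rearrangements of the values with
relative ranks in a given set does not depend on the (distinct) values. -/
lemma card_perm_ranksBefore {x : ℕ → ℝ} (hx : Function.Injective x) (n : ℕ) (S : Set (ℕ → ℕ)) :
    Nat.card {τ : Equiv.Perm (Fin n) // ranksBefore n (x ∘ extPerm τ) ∈ S} =
      Nat.card {τ : Equiv.Perm (Fin n) // ranksBefore n (fun i => (extPerm τ i : ℝ)) ∈ S} := by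
  set y : Fin n → ℝ := fun i => x i
  have hy : StrictMono (y ∘ Tuple.sort y) :=
    (Tuple.monotone_sort y).strictMono_of_injective
      ((hx.comp Fin.val_injective).comp (Tuple.sort y).injective)
  -- Left multiplication by the sorting permutation reparametrizes the rearrangements and turns the
  -- order of the values into that of the indices.
  refine (Nat.card_congr ((Equiv.mulLeft (Tuple.sort y)).subtypeEquiv fun τ => ?_)).symm
  have : ranksBefore n (x ∘ extPerm (Tuple.sort y * τ)) =
      ranksBefore n (fun i => (extPerm τ i : ℝ)) := by
    refine ranksBefore_congr fun k hk i hi => ?_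
    simp only [Function.comp_apply, extPerm_apply_of_lt _ hk, extPerm_apply_of_lt _ hi,
      Equiv.Perm.mul_apply, Nat.cast_le, Fin.val_fin_le]
    exact hy.le_iff_le
  rw [Equiv.coe_mulLeft, this]

/-- The swap puts `x i` in the last place, where its rank counts the larger values among the first
`n + 1`; distinctness turns `≤` into `<`. Averaging over `i` will give uniformity. -/
lemma relRank_comp_swap {x : ℕ → ℝ} (hx : Function.Injective x) {i n : ℕ} (hi : i ≤ n) :
    relRank (x ∘ Equiv.swap i n) n = ((Finset.range (n + 1)).filter fun l => x i < x l).card := by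
  rw [relRank]
  refine Finset.card_bij (fun l _ => Equiv.swap i n l) ?_
    (fun _ _ _ _ h => (Equiv.swap i n).injective h) ?_
  · intro l hl
    simp only [Finset.mem_filter, Finset.mem_range, Function.comp_apply,
      Equiv.swap_apply_right] at hl ⊢
    have h1 : Equiv.swap i n l ≠ i := fun h => by
      have := (Equiv.swap_apply_eq_iff.1 h).trans (Equiv.swap_apply_left i n)
      omega
    refine ⟨?_, lt_of_le_of_ne hl.2 fun h => h1 (hx h).symm⟩
    rw [Equiv.swap_apply_def]
    split_ifs <;> omega
  · intro l hl
    simp only [Finset.mem_filter, Finset.mem_range, Function.comp_apply,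
      Equiv.swap_apply_right] at hl ⊢
    have h1 : l ≠ i := fun h => by simp [h] at hl
    refine ⟨Equiv.swap i n l, ⟨?_, ?_⟩, Equiv.swap_apply_self _ _ _⟩
    · rw [Equiv.swap_apply_def]
      split_ifs <;> omega
    · rw [Equiv.swap_apply_self]
      exact hl.2.le

/-- For distinct values, sending `i` to the number of larger values is a bijection of `range n` onto
itself. -/
lemma card_filter_upper_lt {x : ℕ → ℝ} (hx : Function.Injective x) {n j : ℕ} (hj : j ≤ n) :
    ((Finset.range n).filter fun i =>
      ((Finset.range n).filter fun l => x i < x l).card < j).card = j := by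
  set f : ℕ → ℕ := fun i => ((Finset.range n).filter fun l => x i < x l).card
  have hlt : ∀ i ∈ Finset.range n, ∀ i' ∈ Finset.range n, x i < x i' → f i' < f i := by
    intro i hi i' hi' h
    refine Finset.card_lt_card (Finset.ssubset_iff_subset_ne.2 ⟨?_, fun he => ?_⟩)
    · exact Finset.monotone_filter_right _ fun l _ hl => h.trans hl
    · have : i' ∈ (Finset.range n).filter fun l => x i < x l := by
        simp only [Finset.mem_filter]
        exact ⟨hi', h⟩
      rw [← he] at this
      simp at this
  have hinj : Set.InjOn f (Finset.range n) := by
    intro i hi i' hi' h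
    rcases lt_trichotomy (x i) (x i') with hl | hl | hl
    · exact absurd h (hlt i hi i' hi' hl).ne'
    · exact hx hl
    · exact absurd h (hlt i' hi' i hi hl).ne
  have himg : (Finset.range n).image f = Finset.range n := by
    refine Finset.eq_of_subset_of_card_le ?_ (Finset.card_image_of_injOn hinj).ge
    intro k hk
    obtain ⟨i, hi, rfl⟩ := Finset.mem_image.1 hk
    have : f i < (Finset.range n).card := by
      refine Finset.card_lt_card ((Finset.filter_ssubset).2 ⟨i, hi, by simp⟩)
    simpa using this
  have : ((Finset.range n).filter fun i => f i < j).image f = Finset.range j := by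
    rw [← Finset.filter_image (p := fun k => k < j), himg]
    ext k
    simp only [Finset.mem_filter, Finset.mem_range]
    omega
  rw [← Finset.card_image_of_injOn (hinj.mono (Finset.coe_subset.2 (Finset.filter_subset _ _))), this, Finset.card_range]

/-! ### Ranks of exchangeable values are uniform and independent. -/

section Exchangeable

variable {μ : Measure (ℕ → ℝ)} [IsProbabilityMeasure μ]

/-- Average over all permutations of the first `n` values: exchangeability gives every rearranged
event the same probability, and for each `x` with distinct values the number of rearrangements with
ranks in `S` is one constant. So the earlier ranks are independent of any event unaffected by such
permutations, in particular of one about the rank of candidate `n`. -/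
lemma measureReal_rank_inter_of_invariant
    (hμ : ∀ σ : Equiv.Perm ℕ, MeasurePreserving (fun x : ℕ → ℝ => x ∘ σ) μ μ)
    (hinj : ∀ᵐ x ∂μ, Function.Injective x) (n : ℕ) {S : Set (ℕ → ℕ)} (hS : MeasurableSet S)
    {E : Set (ℕ → ℝ)} (hE : MeasurableSet E)
    (hEinv : ∀ τ : Equiv.Perm (Fin n), ∀ x, x ∘ extPerm τ ∈ E ↔ x ∈ E) :
    (Nat.card (Equiv.Perm (Fin n)) : ℝ) * μ.real (ranksBefore n ⁻¹' S ∩ E) =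
      (Nat.card {τ : Equiv.Perm (Fin n) // ranksBefore n (fun i => (extPerm τ i : ℝ)) ∈ S} : ℝ) *
        μ.real E := by
  classical
  have hB : MeasurableSet (ranksBefore n ⁻¹' S) := measurable_ranksBefore n hS
  have hB' : ∀ τ : Equiv.Perm (Fin n),
      MeasurableSet ((fun x : ℕ → ℝ => x ∘ extPerm τ) ⁻¹' (ranksBefore n ⁻¹' S)) :=
    fun τ => (hμ (extPerm τ)).measurable hB
  have h1 : ∀ τ : Equiv.Perm (Fin n), μ.real (ranksBefore n ⁻¹' S ∩ E) =
      ∫ x in E, ((fun x : ℕ → ℝ => x ∘ extPerm τ) ⁻¹' (ranksBefore n ⁻¹' S)).indicator 1 x ∂μ := by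
    intro τ
    rw [integral_indicator_one (hB' τ), measureReal_restrict_apply (hB' τ),
      ← (hμ (extPerm τ)).measureReal_preimage (hB.inter hE).nullMeasurableSet, Set.preimage_inter]
    congr 2
    ext x
    exact hEinv τ x
  have h2 : ∑ τ : Equiv.Perm (Fin n), μ.real (ranksBefore n ⁻¹' S ∩ E) =
      ∫ x in E, (Nat.card {τ : Equiv.Perm (Fin n) //
        ranksBefore n (fun i => (extPerm τ i : ℝ)) ∈ S} : ℝ) ∂μ := by
    rw [Finset.sum_congr rfl fun τ _ => h1 τ, ← integral_finsetSum]
    · refine integral_congr_ae (ae_restrict_of_ae ?_)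
      filter_upwards [hinj] with x hx
      rw [← card_perm_ranksBefore hx n S, Nat.card_eq_fintype_card, Fintype.card_subtype,
        Finset.card_filter, Nat.cast_sum]
      refine Finset.sum_congr rfl fun τ _ => ?_
      simp [Set.indicator_apply]
    · intro τ _
      exact (integrable_const (1 : ℝ)).indicator (hB' τ)
  rw [setIntegral_const, smul_eq_mul, Finset.sum_const, nsmul_eq_mul, Finset.card_univ,
    ← Nat.card_eq_fintype_card] at h2
  rw [h2, mul_comm]

/-- Average over the `n + 1` swaps of `n` with some `i ≤ n`: for distinct values, exactly `j` of
them produce a rank below `j`. -/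
lemma measureReal_relRank_lt
    (hμ : ∀ σ : Equiv.Perm ℕ, MeasurePreserving (fun x : ℕ → ℝ => x ∘ σ) μ μ)
    (hinj : ∀ᵐ x ∂μ, Function.Injective x) {n j : ℕ} (hj : j ≤ n + 1) :
    μ.real {x | relRank x n < j} = (j : ℝ) / (n + 1) := by
  have hE : MeasurableSet {x : ℕ → ℝ | relRank x n < j} :=
    measurableSet_lt (measurable_relRank n) measurable_const
  have hE' : ∀ i, MeasurableSet
      ((fun x : ℕ → ℝ => x ∘ Equiv.swap i n) ⁻¹' {x : ℕ → ℝ | relRank x n < j}) :=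
    fun i => (hμ (Equiv.swap i n)).measurable hE
  have h1 : ∀ i, μ.real {x | relRank x n < j} = ∫ x,
      ((fun x : ℕ → ℝ => x ∘ Equiv.swap i n) ⁻¹' {x | relRank x n < j}).indicator 1 x ∂μ := by
    intro i
    rw [integral_indicator_one (hE' i),
      (hμ (Equiv.swap i n)).measureReal_preimage hE.nullMeasurableSet]
  have h2 : ∑ i ∈ Finset.range (n + 1), μ.real {x | relRank x n < j} = ∫ _, (j : ℝ) ∂μ := by
    rw [Finset.sum_congr rfl fun i _ => h1 i, ← integral_finsetSum]
    · refine integral_congr_ae ?_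
      filter_upwards [hinj] with x hx
      conv_rhs => rw [← card_filter_upper_lt hx hj, Finset.card_filter, Nat.cast_sum]
      refine Finset.sum_congr rfl fun i hi => ?_
      have := relRank_comp_swap hx (Finset.mem_range_succ_iff.1 hi)
      simp [Set.indicator_apply, this]
    · intro i _
      exact (integrable_const (1 : ℝ)).indicator (hE' i)
  rw [integral_const, Finset.sum_const, Finset.card_range] at h2
  simp only [nsmul_eq_mul, probReal_univ, smul_eq_mul, one_mul] at h2
  rw [eq_div_iff (by positivity), mul_comm, ← h2]
  push_cast
  ring

/-- The relative ranks are independent and uniformly distributed. -/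
lemma measureReal_ranksBefore_inter
    (hμ : ∀ σ : Equiv.Perm ℕ, MeasurePreserving (fun x : ℕ → ℝ => x ∘ σ) μ μ)
    (hinj : ∀ᵐ x ∂μ, Function.Injective x) {n j : ℕ} (hj : j ≤ n + 1)
    {S : Set (ℕ → ℕ)} (hS : MeasurableSet S) :
    μ.real (ranksBefore n ⁻¹' S ∩ {x | relRank x n < j}) =
      (j : ℝ) / (n + 1) * μ.real (ranksBefore n ⁻¹' S) := by
  have hE : MeasurableSet {x : ℕ → ℝ | relRank x n < j} :=
    measurableSet_lt (measurable_relRank n) measurable_const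
  have h1 := measureReal_rank_inter_of_invariant hμ hinj n hS hE
    (fun τ x => by simp [relRank_comp_extPerm])
  have h2 := measureReal_rank_inter_of_invariant hμ hinj n hS MeasurableSet.univ
    (fun τ x => by simp)
  rw [Set.inter_univ, probReal_univ, mul_one] at h2
  rw [← h2, measureReal_relRank_lt hμ hinj hj] at h1
  have hc : (Nat.card (Equiv.Perm (Fin n)) : ℝ) ≠ 0 := by
    exact_mod_cast Nat.card_pos.ne'
  apply mul_left_cancel₀ hc
  rw [h1]
  ring

end Exchangeable

/-! ### From i.i.d. values to the hiring chain. -/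

section IID

variable {Ω : Type*} [MeasurableSpace Ω] {P : Measure Ω}
  {ν : Measure ℝ} {X : ℕ → Ω → ℝ}

lemma map_comp_perm_of_iid (hX : ∀ i, Measurable (X i)) (hlaw : ∀ i, P.map (X i) = ν)
    (hindep : iIndepFun X P) (σ : Equiv.Perm ℕ) :
    MeasurePreserving (fun x : ℕ → ℝ => x ∘ σ) (P.map fun ω i => X i ω)
      (P.map fun ω i => X i ω) := by
  have hm : Measurable fun x : ℕ → ℝ => x ∘ σ :=
    measurable_pi_lambda _ fun i => measurable_pi_apply _
  refine ⟨hm, ?_⟩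
  rw [Measure.map_map hm (measurable_pi_lambda _ hX), hindep.map_fun_eq_infinitePi_map hX]
  have := (hindep.precomp σ.injective).map_fun_eq_infinitePi_map fun i => hX (σ i)
  simp only [hlaw] at this ⊢
  exact this

lemma ae_injective_of_iid [IsProbabilityMeasure P] [NullSingletonClass ν] (hX : ∀ i, Measurable (X i))
    (hlaw : ∀ i, P.map (X i) = ν) (hindep : iIndepFun X P) :
    ∀ᵐ x ∂(P.map fun ω i => X i ω), Function.Injective x := by
  have hne : ∀ i j, i ≠ j → ∀ᵐ x ∂(P.map fun ω i => X i ω), x i ≠ x j := by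
    intro i j hij
    have hms : MeasurableSet {x : ℕ → ℝ | x i ≠ x j} :=
      (measurableSet_eq_fun (measurable_pi_apply i) (measurable_pi_apply j)).compl
    rw [ae_map_iff (measurable_pi_lambda _ hX).aemeasurable hms]
    have hprob : IsProbabilityMeasure ν := hlaw 0 ▸ Measure.isProbabilityMeasure_map (hX 0).aemeasurable
    have h := (indepFun_iff_map_prod_eq_prod_map_map (hX i).aemeasurable (hX j).aemeasurable).1
      (hindep.indepFun hij)
    rw [hlaw, hlaw] at h
    have hd : MeasurableSet {p : ℝ × ℝ | p.1 = p.2} :=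
      measurableSet_eq_fun measurable_fst measurable_snd
    have h0 : (ν.prod ν) {p : ℝ × ℝ | p.1 = p.2} = 0 := by
      rw [Measure.measure_prod_null hd]
      refine Eventually.of_forall fun x => ?_
      have : Prod.mk x ⁻¹' {p : ℝ × ℝ | p.1 = p.2} = {x} := by
        ext y
        simp [eq_comm]
      show ν (Prod.mk x ⁻¹' {p : ℝ × ℝ | p.1 = p.2}) = 0
      rw [this]
      exact measure_singleton x
    rw [← h, Measure.map_apply ((hX i).prodMk (hX j)) hd] at h0
    rw [ae_iff]
    simpa using h0
  have : ∀ᵐ x ∂(P.map fun ω i => X i ω), ∀ i j, i ≠ j → x i ≠ x j := by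
    simp only [ae_all_iff]
    exact hne
  filter_upwards [this] with x hx i j h
  by_contra hij
  exact hx i j hij h

/-- The filtration generated by the relative ranks. -/
noncomputable def rankFiltration (hX : ∀ i, Measurable (X i)) :
    Filtration ℕ (inferInstance : MeasurableSpace Ω) where
  seq n := MeasurableSpace.comap (fun ω => ranksBefore n fun i => X i ω) inferInstance
  mono' := by
    intro m n hmn
    have : (fun ω => ranksBefore m fun i => X i ω) =
        (fun (ρ : ℕ → ℕ) k => if k < m then ρ k else 0) ∘
          fun ω => ranksBefore n fun i => X i ω := by
      funext ω k
      simp only [Function.comp_apply, ranksBefore]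
      split_ifs <;> first | rfl | omega
    have hm : Measurable fun (ρ : ℕ → ℕ) k => if k < m then ρ k else 0 := by
      refine measurable_pi_lambda _ fun k => ?_
      split_ifs
      · exact measurable_pi_apply k
      · exact measurable_const
    show MeasurableSpace.comap _ _ ≤ MeasurableSpace.comap _ _
    rw [this, ← MeasurableSpace.comap_comp]
    exact MeasurableSpace.comap_mono hm.comap_le
  le' n := ((measurable_ranksBefore n).comp (measurable_pi_lambda _ hX)).comap_le

/-- A process `M` that starts from `0` and, at time `n + 1`, moves from `m` to `m + 1` with the
conditional probability `r m / (n + 1)`. -/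
structure IsHiringChain (r : ℕ → ℕ) (P : Measure Ω)
    (ℱ : Filtration ℕ (inferInstance : MeasurableSpace Ω)) (M : ℕ → Ω → ℕ) : Prop where
  measurableSet_eq : ∀ n m, MeasurableSet[ℱ n] {ω | M n ω = m}
  zero : ∀ ω, M 0 ω = 0
  succ : ∀ n ω, M (n + 1) ω = M n ω ∨ M (n + 1) ω = M n ω + 1
  prob : ∀ n m A, MeasurableSet[ℱ n] A → A ⊆ {ω | M n ω = m} →
    P.real (A ∩ {ω | M (n + 1) ω = m + 1}) = (r m : ℝ) / (n + 1) * P.real A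

lemma hires_le (r ρ : ℕ → ℕ) (n : ℕ) : hires r ρ n ≤ n := by
  induction n with
  | zero => rfl
  | succ n ih =>
    rw [hires]
    split_ifs <;> omega

lemma isHiringChain_hires [IsProbabilityMeasure P] [NullSingletonClass ν] (hX : ∀ i, Measurable (X i))
    (hlaw : ∀ i, P.map (X i) = ν) (hindep : iIndepFun X P) {r : ℕ → ℕ} (hr : IsRankFunction r) :
    IsHiringChain r P (rankFiltration hX)
      fun n ω => hires r (relRank fun i => X i ω) n where
  measurableSet_eq n m := by
    refine ⟨{ρ | hires r ρ n = m}, measurable_hires r n (measurableSet_singleton m), ?_⟩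
    ext ω
    have : hires r (ranksBefore n fun i => X i ω) n = hires r (relRank fun i => X i ω) n :=
      hires_congr r fun k hk => by simp [ranksBefore, hk]
    simp [this]
  zero ω := rfl
  succ n ω := by
    rw [hires]
    split_ifs <;> simp
  prob n m A hA hAm := by
    obtain ⟨S, hS, rfl⟩ := hA
    -- For an empty event `m` may exceed `n`, and the identity is `0 = 0`. Otherwise `m ≤ n`, so `r
    -- m ≤ m + 1 ≤ n + 1` is an admissible rank bound.
    rcases Set.eq_empty_or_nonempty ((fun ω => ranksBefore n fun i => X i ω) ⁻¹' S) with h | ⟨ω, hω⟩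
    · simp [h]
    have hmn : m ≤ n := (hAm hω).symm ▸ hires_le _ _ _
    have hXm : Measurable fun ω i => X i ω := measurable_pi_lambda _ hX
    have : IsProbabilityMeasure (P.map fun ω i => X i ω) :=
      Measure.isProbabilityMeasure_map hXm.aemeasurable
    have key := measureReal_ranksBefore_inter (map_comp_perm_of_iid hX hlaw hindep)
      (ae_injective_of_iid hX hlaw hindep) ((hr.le_succ m).trans (by omega) : r m ≤ n + 1) hS
    have hB : MeasurableSet (ranksBefore n ⁻¹' S) := measurable_ranksBefore n hS
    have hE : MeasurableSet {x : ℕ → ℝ | relRank x n < r m} :=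
      measurableSet_lt (measurable_relRank n) measurable_const
    rw [map_measureReal_apply hXm (hB.inter hE), map_measureReal_apply hXm hB] at key
    rw [Set.preimage_comp (f := fun ω i => X i ω) (g := ranksBefore n) (s := S) |>.symm] at key
    refine Eq.trans ?_ key
    congr 1
    ext ω
    simp only [Set.mem_inter_iff, Set.mem_preimage, Set.mem_ofPred_eq]
    refine and_congr_right fun hω => ?_
    have hm : hires r (relRank fun i => X i ω) n = m := hAm hω
    rw [hires, hm]
    split_ifs with h <;> simp [h]

end IID

/-! ### Products attached to roughly linear sequences. -/

/-- The product `∏ (1 + l / q k)` over `a ≤ k < m`. -/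
noncomputable def linProd {𝕜 : Type*} [RCLike 𝕜] (q : ℕ → ℝ) (l : 𝕜) (a m : ℕ) : 𝕜 :=
  ∏ k ∈ Finset.Ico a m, (1 + l / (q k : 𝕜))

lemma linProd_ofReal (q : ℕ → ℝ) (l : ℝ) (a m : ℕ) :
    linProd q (l : ℂ) a m = ((linProd q l a m : ℝ) : ℂ) := by
  simp [linProd]

lemma linProd_self {𝕜 : Type*} [RCLike 𝕜] (q : ℕ → ℝ) (l : 𝕜) {a m : ℕ} (h : m ≤ a) :
    linProd q l a m = 1 := by
  simp [linProd, Finset.Ico_eq_empty_of_le h]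

lemma linProd_succ {𝕜 : Type*} [RCLike 𝕜] (q : ℕ → ℝ) (l : 𝕜) {a m : ℕ} (h : a ≤ m) :
    linProd q l a (m + 1) = linProd q l a m * (1 + l / (q m : 𝕜)) := by
  rw [linProd, Finset.prod_Ico_succ_top h, linProd]

lemma linProd_mul {𝕜 : Type*} [RCLike 𝕜] (q : ℕ → ℝ) (l : 𝕜) {a b m : ℕ} (h : a ≤ b)
    (h' : b ≤ m) : linProd q l a b * linProd q l b m = linProd q l a m :=
  Finset.prod_Ico_consecutive _ h h'

lemma tendsto_sum_Ico_one_div_sub_log :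
    Tendsto (fun m : ℕ => ∑ k ∈ Finset.Ico 1 m, 1 / (k : ℝ) - Real.log m) atTop
      (𝓝 Real.eulerMascheroniConstant) := by
  rw [← tendsto_add_atTop_iff_nat 1]
  refine Real.tendsto_harmonic_sub_log_add_one.congr fun m => ?_
  rw [harmonic_eq_sum_Icc, Nat.cast_add_one]
  push_cast
  simp only [one_div]
  congr 1

/-- `q` is roughly linear with slope `α`. -/
def RoughlyLinearSeq (q : ℕ → ℝ) (α : ℝ) : Prop :=
  Summable fun m : ℕ => 1 / q (m + 1) - 1 / (α * ((m : ℝ) + 1))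

lemma roughlyLinearSeq_natCast : RoughlyLinearSeq (fun k => (k : ℝ)) 1 := by
  simp [RoughlyLinearSeq, summable_zero]

/-- This sequence describes the time side of the moment identity, whose factors are `1 + l / (k +
1)`; both sides then obey the same asymptotics. -/
lemma roughlyLinearSeq_natCast_add_one : RoughlyLinearSeq (fun k => (k : ℝ) + 1) 1 := by
  have h : Summable fun m : ℕ => 1 / ((m : ℝ) + 1) ^ 2 := by
    simpa using (summable_nat_add_iff (f := fun m : ℕ => 1 / (m : ℝ) ^ 2) 1).2
      (Real.summable_one_div_nat_pow.2 one_lt_two)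
  refine h.of_norm_bounded fun m => ?_
  have h1 : (0 : ℝ) < (m : ℝ) + 1 := by positivity
  have h2 : (1 : ℝ) / ((m + 1 : ℕ) + 1) - 1 / (1 * ((m : ℝ) + 1)) =
      - (1 / (((m : ℝ) + 1) * (m + 1 + 1))) := by
    push_cast
    field_simp
    ring
  rw [h2, norm_neg, Real.norm_of_nonneg (by positivity)]
  apply one_div_le_one_div_of_le (by positivity)
  nlinarith

section RoughlyLinearSeq

variable {q : ℕ → ℝ} {α : ℝ}

/-- Comparison with the harmonic sum: the error series converges and the harmonic sum contributes
Euler's constant. This fixes the constants in the law of `W`. -/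
lemma RoughlyLinearSeq.tendsto_sum (hq : RoughlyLinearSeq q α) :
    Tendsto (fun m : ℕ => ∑ k ∈ Finset.Ico 1 m, 1 / q k - Real.log m / α) atTop
      (𝓝 ((∑' m : ℕ, (1 / q (m + 1) - 1 / (α * ((m : ℝ) + 1))))
        + Real.eulerMascheroniConstant / α)) := by
  have h1 := hq.hasSum.tendsto_sum_nat
  have h2 := tendsto_sum_Ico_one_div_sub_log.div_const α
  rw [← tendsto_add_atTop_iff_nat 1] at h2 ⊢
  refine (h1.add h2).congr fun m => ?_
  rw [Finset.sum_Ico_eq_sum_range, Finset.sum_Ico_eq_sum_range, Nat.add_sub_cancel,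
    Finset.sum_sub_distrib, sub_div, Finset.sum_div]
  simp only [add_comm 1, Nat.cast_add_one]
  have : ∀ x : ℕ, 1 / (α * ((x : ℝ) + 1)) = 1 / ((x : ℝ) + 1) / α := fun x => by
    rw [div_div, mul_comm]
  simp only [this]
  ring

lemma RoughlyLinearSeq.summable_sq (hq : RoughlyLinearSeq q α) :
    Summable fun m : ℕ => (1 / q (m + 1)) ^ 2 := by
  have h : Summable fun m : ℕ => 1 / ((m : ℝ) + 1) ^ 2 := by
    simpa using (summable_nat_add_iff (f := fun m : ℕ => 1 / (m : ℝ) ^ 2) 1).2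
      (Real.summable_one_div_nat_pow.2 one_lt_two)
  have h2 : Summable fun m : ℕ => (1 / q (m + 1) - 1 / (α * ((m : ℝ) + 1))) ^ 2 := by
    refine summable_of_isBigO_nat hq ?_
    have := (Asymptotics.isBigO_refl (fun m : ℕ => 1 / q (m + 1) - 1 / (α * ((m : ℝ) + 1)))
      atTop).mul (hq.tendsto_atTop_zero.isBigO_one ℝ)
    simpa [sq] using this
  refine ((h2.mul_left 2).add (h.mul_left (2 / α ^ 2))).of_norm_bounded fun m => ?_
  rw [Real.norm_of_nonneg (sq_nonneg _)]
  set a := 1 / q (m + 1)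
  have e : 2 / α ^ 2 * (1 / ((m : ℝ) + 1) ^ 2) = 2 * (1 / (α * ((m : ℝ) + 1))) ^ 2 := by
    rw [div_pow, mul_pow, one_pow, div_mul_div_comm, mul_one, mul_one_div]
  rw [e]
  nlinarith [sq_nonneg (a - 1 / (α * ((m : ℝ) + 1)) - 1 / (α * ((m : ℝ) + 1)))]

/-- The factor `exp (-u)` cancels the linear term, leaving a quadratic error. -/
lemma summable_one_add_mul_exp_neg_sub_one {u : ℕ → ℂ} (hu : Summable fun k => ‖u k‖ ^ 2) :
    Summable fun k => ‖(1 + u k) * Complex.exp (-u k) - 1‖ := by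
  have h0 : Tendsto (fun k => ‖u k‖) atTop (𝓝 0) := by
    have := hu.tendsto_atTop_zero.sqrt
    simpa using this
  refine Summable.of_norm_bounded_eventually_nat (g := fun k => 3 * ‖u k‖ ^ 2) (hu.mul_left 3) ?_
  filter_upwards [h0.eventually (ge_mem_nhds zero_lt_one)] with k hk
  rw [norm_norm]
  have h1 := Complex.norm_exp_sub_one_sub_id_le (x := -u k) (by simpa using hk)
  have h2 : (1 + u k) * Complex.exp (-u k) - 1 =
      (1 + u k) * (Complex.exp (-u k) - 1 - -u k) + -(u k ^ 2) := by ring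
  rw [h2]
  refine (norm_add_le _ _).trans ?_
  rw [norm_mul, norm_neg, norm_pow]
  have h3 : ‖1 + u k‖ ≤ 2 := (norm_add_le _ _).trans (by simp; linarith)
  rw [norm_neg] at h1
  nlinarith [mul_le_mul h3 h1 (norm_nonneg _) (by norm_num)]

/-- The convergence of the products `∏ (1 + u k) e^{-u k}`. -/
lemma tendsto_prod_one_add_mul_exp_neg {u : ℕ → ℂ} (hu : Summable fun k => ‖u k‖ ^ 2) :
    ∃ C : ℂ, Tendsto (fun n => ∏ k ∈ Finset.range n, (1 + u k) * Complex.exp (-u k)) atTop (𝓝 C) ∧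
      ((∀ k, 1 + u k ≠ 0) → C ≠ 0) := by
  have hs := summable_one_add_mul_exp_neg_sub_one hu
  refine ⟨∏' k, (1 + ((1 + u k) * Complex.exp (-u k) - 1)), ?_, fun h => ?_⟩
  · have := (multipliable_one_add_of_summable hs).hasProd.tendsto_prod_nat
    simpa using this
  · exact tprod_one_add_ne_zero_of_summable (fun k => by simpa using h k) hs

/-- The asymptotics of the products `∏ (1 + α s / q k)`. -/
lemma RoughlyLinearSeq.tendsto_linProd (hq : RoughlyLinearSeq q α) (hα : 0 < α) (s : ℂ) (a : ℕ) :
    ∃ C : ℂ, Tendsto (fun m : ℕ => linProd q (α * s) a m * (m : ℂ) ^ (-s)) atTop (𝓝 C) ∧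
      ((∀ k ≥ a, 1 + α * s / (q k : ℂ) ≠ 0) → C ≠ 0) := by
  -- the case `a ≥ 1`
  have key : ∀ b : ℕ, ∃ C : ℂ,
      Tendsto (fun m : ℕ => linProd q (α * s) (b + 1) m * (m : ℂ) ^ (-s)) atTop (𝓝 C) ∧
      ((∀ k ≥ b + 1, 1 + α * s / (q k : ℂ) ≠ 0) → C ≠ 0) := by
    intro b
    have hu : Summable fun k => ‖α * s / (q (k + (b + 1)) : ℂ)‖ ^ 2 := by
      have h := ((summable_nat_add_iff b).2 hq.summable_sq).mul_left (‖α * s‖ ^ 2)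
      refine h.congr fun k => ?_
      rw [norm_div, div_pow, div_pow, Complex.norm_real, Real.norm_eq_abs, sq_abs, add_assoc,
        one_pow, mul_one_div]
    obtain ⟨C, hC, hC0⟩ := tendsto_prod_one_add_mul_exp_neg hu
    set ρ := (∑' m : ℕ, (1 / q (m + 1) - 1 / (α * ((m : ℝ) + 1))))
        + Real.eulerMascheroniConstant / α
    have h1 := hq.tendsto_sum
    -- What the compensated product leaves over is the exponential of `∑ α s / q k - s log m`, which
    -- converges.
    have h2 : Tendsto (fun m : ℕ => Complex.exp (α * s *
        ((((∑ k ∈ Finset.Ico 1 m, 1 / q k - Real.log m / α) -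
          ∑ k ∈ Finset.Ico 1 (b + 1), 1 / q k : ℝ)) : ℂ))) atTop
        (𝓝 (Complex.exp (α * s * ((ρ - ∑ k ∈ Finset.Ico 1 (b + 1), 1 / q k : ℝ) : ℂ)))) := by
      refine (Complex.continuous_exp.tendsto _).comp (Tendsto.const_mul _ ?_)
      exact (Complex.continuous_ofReal.tendsto _).comp (h1.sub_const _)
    refine ⟨C * Complex.exp (α * s * ((ρ - ∑ k ∈ Finset.Ico 1 (b + 1), 1 / q k : ℝ) : ℂ)),
      ?_, fun h => ?_⟩
    · have h3 := hC.mul ((tendsto_add_atTop_iff_nat (b + 1)).2 h2)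
      rw [← tendsto_add_atTop_iff_nat (b + 1)]
      refine h3.congr fun m => ?_
      rw [Finset.prod_mul_distrib, mul_assoc, ← Complex.exp_sum, ← Complex.exp_add]
      have e1 : ∏ k ∈ Finset.range m, (1 + α * s / (q (k + (b + 1)) : ℂ)) =
          linProd q (α * s) (b + 1) (m + (b + 1)) := by
        rw [linProd, Finset.prod_Ico_eq_prod_range, Nat.add_sub_cancel]
        simp [add_comm]
      rw [e1]
      congr 1
      have hm : ((m + (b + 1) : ℕ) : ℂ) ≠ 0 := by
        exact_mod_cast (by omega : m + (b + 1) ≠ 0)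
      rw [Complex.cpow_def_of_ne_zero hm, ← Complex.natCast_log]
      congr 1
      have e2 : ∑ k ∈ Finset.Ico 1 (m + (b + 1)), 1 / q k = ∑ k ∈ Finset.Ico 1 (b + 1), 1 / q k +
          ∑ k ∈ Finset.range m, 1 / q (k + (b + 1)) := by
        rw [← Finset.sum_Ico_consecutive _ (by omega : 1 ≤ b + 1) (by omega : b + 1 ≤ m + (b + 1)),
          Finset.sum_Ico_eq_sum_range _ (b + 1), Nat.add_sub_cancel]
        simp [add_comm]
      rw [e2]
      have e3 : ∑ k ∈ Finset.range m, -(α * s / (q (k + (b + 1)) : ℂ)) =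
          - (α * s * ∑ k ∈ Finset.range m, 1 / (q (k + (b + 1)) : ℂ)) := by
        rw [Finset.sum_neg_distrib, Finset.mul_sum]
        simp [div_eq_mul_inv]
      rw [e3]
      have hα' : (α : ℂ) ≠ 0 := by exact_mod_cast hα.ne'
      push_cast
      field_simp
      ring
    · exact mul_ne_zero (hC0 fun k => h _ (by omega)) (Complex.exp_ne_zero _)
  cases a with
  | succ b => exact key b
  | zero =>
    obtain ⟨C, hC, hC0⟩ := key 0
    -- Rough linearity says nothing about `q 0`, so its factor is split off.
    refine ⟨(1 + α * s / (q 0 : ℂ)) * C, ?_, fun h =>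
      mul_ne_zero (h 0 le_rfl) (hC0 fun k _ => h k (Nat.zero_le k))⟩
    refine (hC.const_mul (1 + α * s / (q 0 : ℂ))).congr' ?_
    filter_upwards [eventually_ge_atTop 1] with m hm
    rw [← linProd_mul q (α * s) (Nat.zero_le 1) hm, ← mul_assoc]
    congr 2
    simp [linProd]

lemma linProd_pos {q : ℕ → ℝ} {l : ℝ} {a : ℕ} (h : ∀ k ≥ a, 0 < 1 + l / q k) (m : ℕ) :
    0 < linProd q l a m :=
  Finset.prod_pos fun k hk => by simpa using h k (Finset.mem_Ico.1 hk).1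

lemma RoughlyLinearSeq.tendsto_linProd_real (hq : RoughlyLinearSeq q α) (hα : 0 < α) (s : ℝ)
    (a : ℕ) (h : ∀ k ≥ a, 0 < 1 + α * s / q k) :
    ∃ C : ℝ, 0 < C ∧
      Tendsto (fun m : ℕ => linProd q (α * s) a m * (m : ℝ) ^ (-s)) atTop (𝓝 C) := by
  obtain ⟨C, hC, hC0⟩ := hq.tendsto_linProd hα (s : ℂ) a
  refine ⟨‖C‖, norm_pos_iff.2 (hC0 fun k hk => ?_), ?_⟩
  · exact_mod_cast (h k hk).ne'
  · refine hC.norm.congr' ?_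
    filter_upwards [eventually_ge_atTop 1] with m hm
    rw [norm_mul, ← Complex.ofReal_mul, linProd_ofReal, Complex.norm_real,
      Real.norm_of_nonneg (linProd_pos h m).le, Complex.norm_natCast_cpow_of_pos hm]
    simp

end RoughlyLinearSeq

/-! ### One-step expectations and exact moments of the chain. -/

section Chain

variable {Ω : Type*} [MeasurableSpace Ω] {P : Measure Ω}
  {ℱ : Filtration ℕ (inferInstance : MeasurableSpace Ω)} {M : ℕ → Ω → ℕ} {r : ℕ → ℕ}

lemma IsHiringChain.le (hM : IsHiringChain r P ℱ M) (n : ℕ) (ω : Ω) : M n ω ≤ n := by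
  induction n with
  | zero => rw [hM.zero]
  | succ n ih => rcases hM.succ n ω with h | h <;> omega

lemma IsHiringChain.monotone (hM : IsHiringChain r P ℱ M) (ω : Ω) : Monotone fun n => M n ω :=
  monotone_nat_of_le_succ fun n => by rcases hM.succ n ω with h | h <;> omega

lemma IsHiringChain.measurable_filtration (hM : IsHiringChain r P ℱ M) (n : ℕ) :
    Measurable[ℱ n] (M n) :=
  @measurable_to_countable' ℕ Ω _ _ (ℱ n) (M n) fun m => hM.measurableSet_eq n m

lemma IsHiringChain.measurable (hM : IsHiringChain r P ℱ M) (n : ℕ) : Measurable (M n) :=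
  (hM.measurable_filtration n).mono (ℱ.le n) le_rfl

variable {𝕜 : Type*} [RCLike 𝕜]

lemma IsHiringChain.integrable_comp [IsProbabilityMeasure P] (hM : IsHiringChain r P ℱ M)
    (g : ℕ → 𝕜) (n : ℕ) : Integrable (fun ω => g (M n ω)) P := by
  refine Integrable.of_bound ((measurable_from_top.comp (hM.measurable n)).aestronglyMeasurable)
    (∑ m ∈ Finset.range (n + 1), ‖g m‖) (Eventually.of_forall fun ω => ?_)
  exact Finset.single_le_sum (f := fun m => ‖g m‖) (fun _ _ => norm_nonneg _)
    (Finset.mem_range_succ_iff.2 (hM.le n ω))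

/-- One step of the chain. -/
lemma IsHiringChain.setIntegral_succ [IsProbabilityMeasure P] (hM : IsHiringChain r P ℱ M)
    (g : ℕ → 𝕜) (n : ℕ) {A : Set Ω} (hA : MeasurableSet[ℱ n] A) :
    ∫ ω in A, g (M (n + 1) ω) ∂P =
      ∫ ω in A, (g (M n ω) + (r (M n ω) : 𝕜) / (n + 1) * (g (M n ω + 1) - g (M n ω))) ∂P := by
  have hAm : ∀ m, MeasurableSet[ℱ n] (A ∩ {ω | M n ω = m}) :=
    fun m => hA.inter (hM.measurableSet_eq n m)
  -- Since `M n ≤ n`, the event splits into finitely many pieces on which `M n` is constant and the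
  -- transition probability applies.
  have hU : A = ⋃ m ∈ Finset.range (n + 1), A ∩ {ω | M n ω = m} := by
    ext ω
    simp only [Set.mem_iUnion, Set.mem_inter_iff, Set.mem_ofPred_eq, Finset.mem_range, exists_prop]
    exact ⟨fun h => ⟨_, Nat.lt_succ_of_le (hM.le n ω), h, rfl⟩, fun ⟨_, _, h, _⟩ => h⟩
  have hdisj : (↑(Finset.range (n + 1)) : Set ℕ).Pairwise
      (Function.onFun Disjoint fun m => A ∩ {ω | M n ω = m}) := by
    intro m _ m' _ hne
    rw [Function.onFun, Set.disjoint_left]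
    rintro ω ⟨_, h⟩ ⟨_, h'⟩
    exact hne (h.symm.trans h')
  have hI : ∀ f : ℕ → 𝕜, ∀ k, Integrable (fun ω => f (M k ω)) P := fun f k => hM.integrable_comp f k
  rw [hU, integral_biUnion_finset _ (fun m _ => ℱ.le n _ (hAm m)) hdisj
      (fun m _ => (hI g (n + 1)).integrableOn),
    integral_biUnion_finset _ (fun m _ => ℱ.le n _ (hAm m)) hdisj
      (fun m _ => (hI (fun k => g k + (r k : 𝕜) / (n + 1) * (g (k + 1) - g k)) n).integrableOn)]
  refine Finset.sum_congr rfl fun m _ => ?_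
  set B := A ∩ {ω | M n ω = m}
  have hB : MeasurableSet B := ℱ.le n _ (hAm m)
  set T : Set Ω := {ω | M (n + 1) ω = m + 1}
  have hT : MeasurableSet T := hM.measurable (n + 1) (measurableSet_singleton (m + 1))
  have h1 : ∫ ω in B, g (M (n + 1) ω) ∂P =
      ∫ ω in B, (g m + T.indicator (fun _ => g (m + 1) - g m) ω) ∂P := by
    refine setIntegral_congr_fun hB fun ω hω => ?_
    have hm : M n ω = m := hω.2
    by_cases h : M (n + 1) ω = m + 1
    · simp [T, h]
    · have : M (n + 1) ω = m := by rcases hM.succ n ω with h' | h' <;> omega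
      simp [T, this]
  have h2 : ∫ ω in B, (g (M n ω) + (r (M n ω) : 𝕜) / (n + 1) * (g (M n ω + 1) - g (M n ω))) ∂P =
      ∫ ω in B, (g m + (r m : 𝕜) / (n + 1) * (g (m + 1) - g m)) ∂P := by
    refine setIntegral_congr_fun hB fun ω hω => ?_
    have hm : M n ω = m := hω.2
    simp [hm]
  rw [h1, h2, integral_add (integrable_const _) ((integrable_const _).indicator hT),
    setIntegral_const, setIntegral_const, integral_indicator_const _ hT,
    measureReal_restrict_apply hT, Set.inter_comm, hM.prob n m B (hAm m) Set.inter_subset_right]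
  simp only [RCLike.real_smul_eq_coe_mul]
  push_cast
  ring

/-- Initially every candidate is accepted. -/
lemma IsHiringChain.ae_eq_of_le [IsProbabilityMeasure P] (hM : IsHiringChain r P ℱ M) {a : ℕ}
    (ha : ∀ k < a, r k = k + 1) {n : ℕ} (hn : n ≤ a) : ∀ᵐ ω ∂P, M n ω = n := by
  induction n with
  | zero => exact Eventually.of_forall hM.zero
  | succ n ih =>
    have h := hM.prob n n {ω | M n ω = n} (hM.measurableSet_eq n n) subset_rfl
    have hms' : MeasurableSet {ω | M n ω = n} := hM.measurable n (measurableSet_singleton n)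
    have h1 : P.real {ω | M n ω = n} = 1 := by
      rw [measureReal_def, (prob_compl_eq_zero_iff hms').1 (ih (by omega))]
      rfl
    rw [h1, ha n (by omega)] at h
    have hn0 : ((n : ℝ) + 1) ≠ 0 := by positivity
    rw [Nat.cast_add_one, div_self hn0, mul_one] at h
    have h2 : P.real {ω | M (n + 1) ω = n + 1} = 1 :=
      le_antisymm measureReal_le_one (h ▸ measureReal_mono Set.inter_subset_right)
    have hms : MeasurableSet {ω | M (n + 1) ω = n + 1} :=
      hM.measurable (n + 1) (measurableSet_singleton (n + 1))
    refine (prob_compl_eq_zero_iff hms).2 ?_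
    rw [measureReal_def] at h2
    rwa [← ENNReal.toReal_eq_one_iff]

lemma IsHiringChain.ae_le [IsProbabilityMeasure P] (hM : IsHiringChain r P ℱ M) {a : ℕ}
    (ha : ∀ k < a, r k = k + 1) : ∀ᵐ ω ∂P, ∀ n ≥ a, a ≤ M n ω := by
  filter_upwards [hM.ae_eq_of_le ha le_rfl] with ω hω n hn
  exact hω ▸ hM.monotone ω hn

/-- The increment of the product at `m` is `l / r m` times its value, and the transition probability
`r m / (n + 1)` cancels `r m`. Only states `m ≥ a` matter, which is where the recursion of the
product is valid. -/
lemma IsHiringChain.setIntegral_linProd_succ [IsProbabilityMeasure P] (hM : IsHiringChain r P ℱ M)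
    (hr : ∀ k, 1 ≤ r k) {a : ℕ} (ha : ∀ k < a, r k = k + 1) (l : 𝕜) {n : ℕ} (hn : a ≤ n)
    {A : Set Ω} (hA : MeasurableSet[ℱ n] A) :
    ∫ ω in A, linProd (fun k => (r k : ℝ)) l a (M (n + 1) ω) ∂P =
      (1 + l / (n + 1)) * ∫ ω in A, linProd (fun k => (r k : ℝ)) l a (M n ω) ∂P := by
  rw [hM.setIntegral_succ (linProd (fun k => (r k : ℝ)) l a) n hA, ← integral_const_mul]
  refine integral_congr_ae (ae_restrict_of_ae ?_)
  filter_upwards [hM.ae_le ha] with ω hω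
  rw [linProd_succ _ _ (hω n hn)]
  have h1 : (r (M n ω) : 𝕜) ≠ 0 := by
    have := hr (M n ω)
    exact_mod_cast (by omega : r (M n ω) ≠ 0)
  simp only [RCLike.ofReal_natCast]
  field_simp
  ring

/-- The exact moments of the chain. -/
lemma IsHiringChain.integral_linProd [IsProbabilityMeasure P] (hM : IsHiringChain r P ℱ M)
    (hr : ∀ k, 1 ≤ r k) {a : ℕ} (ha : ∀ k < a, r k = k + 1) (l : 𝕜) {n : ℕ} (hn : a ≤ n) :
    ∫ ω, linProd (fun k => (r k : ℝ)) l a (M n ω) ∂P = linProd (fun k => (k : ℝ) + 1) l a n := by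
  induction n, hn using Nat.le_induction with
  | base =>
    have : ∫ ω, linProd (fun k => (r k : ℝ)) l a (M a ω) ∂P = ∫ ω, (1 : 𝕜) ∂P := by
      refine integral_congr_ae ?_
      filter_upwards [hM.ae_eq_of_le ha le_rfl] with ω hω
      rw [hω, linProd_self _ _ le_rfl]
    rw [this, linProd_self _ _ le_rfl]
    simp
  | succ n hn ih =>
    have h := hM.setIntegral_linProd_succ hr ha l hn MeasurableSet.univ
    rw [setIntegral_univ, setIntegral_univ, ih] at h
    rw [h, linProd_succ _ _ hn, mul_comm]
    simp

end Chain

/-! ### Bounds for real moments. -/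

/-- The exponents `s` for which the moments are controlled by the products started from `a`. -/
structure AdmissibleExponent (r : ℕ → ℕ) (α : ℝ) (a : ℕ) (s : ℝ) : Prop where
  rank_eq : ∀ k ≤ a, r k = k + 1
  lt : -((a : ℝ) + 1) < α * s

/-- By monotonicity `r k ≥ r a = a + 1 > -α s` for `k ≥ a`. -/
lemma AdmissibleExponent.pos_rank {r : ℕ → ℕ} (hr : IsRankFunction r) {α s : ℝ} {a : ℕ}
    (h : AdmissibleExponent r α a s) : ∀ k ≥ a, 0 < 1 + α * s / (r k : ℝ) := by
  intro k hk
  have h1 : ((a : ℝ) + 1) ≤ r k := by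
    have := hr.monotone hk
    rw [h.rank_eq a le_rfl] at this
    exact_mod_cast this
  have h2 : (0 : ℝ) < r k := by linarith [(Nat.cast_nonneg a : (0 : ℝ) ≤ a)]
  have : 1 + α * s / (r k : ℝ) = (r k + α * s) / r k := by field_simp
  rw [this]
  exact div_pos (by linarith [h.lt]) h2

lemma AdmissibleExponent.pos_succ {r : ℕ → ℕ} {α s : ℝ} {a : ℕ}
    (h : AdmissibleExponent r α a s) : ∀ k ≥ a, 0 < 1 + 1 * (α * s) / ((k : ℝ) + 1) := by
  intro k hk
  have h1 : ((a : ℝ)) ≤ k := by exact_mod_cast hk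
  have h2 : (0 : ℝ) < (k : ℝ) + 1 := by positivity
  have : 1 + 1 * (α * s) / ((k : ℝ) + 1) = ((k : ℝ) + 1 + α * s) / ((k : ℝ) + 1) := by field_simp
  rw [this]
  exact div_pos (by linarith [h.lt]) h2

section Moments

variable {Ω : Type*} [MeasurableSpace Ω] {P : Measure Ω} [IsProbabilityMeasure P]
  {ℱ : Filtration ℕ (inferInstance : MeasurableSpace Ω)} {M : ℕ → Ω → ℕ} {r : ℕ → ℕ} {α : ℝ}

lemma IsHiringChain.ae_one_le (hM : IsHiringChain r P ℱ M) (hr : IsRankFunction r) :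
    ∀ᵐ ω ∂P, ∀ n ≥ 1, 1 ≤ M n ω :=
  hM.ae_le fun k hk => by
    obtain rfl : k = 0 := by omega
    exact hr.1

/-- The moments of `M n / n ^ α` are bounded. -/
lemma IsHiringChain.exists_moment_le (hM : IsHiringChain r P ℱ M) (hr : IsRankFunction r)
    (hα : 0 < α) (hq : RoughlyLinearSeq (fun k => (r k : ℝ)) α) {s : ℝ} {a : ℕ}
    (hs : AdmissibleExponent r α a s) :
    ∃ K : ℝ, ∀ n ≥ max a 1, ∫ ω, ((M n ω : ℝ) / (n : ℝ) ^ α) ^ s ∂P ≤ K := by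
  obtain ⟨C, hC, hCt⟩ := hq.tendsto_linProd_real hα s a (hs.pos_rank hr)
  obtain ⟨D, hD, hDt⟩ := roughlyLinearSeq_natCast_add_one.tendsto_linProd_real one_pos (α * s) a
    hs.pos_succ
  -- Convergent sequences are bounded: for positive arguments `K₁` bounds `m ^ s` divided by the
  -- product, and `K₂` bounds the time product divided by `n ^ (α s)`.
  obtain ⟨K₁, hK₁⟩ := (hCt.inv₀ hC.ne').bddAbove_range
  obtain ⟨K₂, hK₂⟩ := hDt.bddAbove_range
  have hK₁0 : 0 ≤ K₁ := le_trans (inv_nonneg.2 (mul_nonneg (linProd_pos (hs.pos_rank hr) 0).le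
    (Real.rpow_nonneg (Nat.cast_nonneg 0) _))) (hK₁ ⟨0, rfl⟩)
  refine ⟨K₁ * K₂, fun n hn => ?_⟩
  have hn1 : (0 : ℝ) < n := by exact_mod_cast (le_max_right a 1).trans hn
  have hna : a ≤ n := (le_max_left a 1).trans hn
  have h1 : ∫ ω, ((M n ω : ℝ) / (n : ℝ) ^ α) ^ s ∂P ≤
      ∫ ω, K₁ * (n : ℝ) ^ (-(α * s)) * linProd (fun k => (r k : ℝ)) (α * s) a (M n ω) ∂P := by
    refine integral_mono_ae (hM.integrable_comp (fun m => ((m : ℝ) / (n : ℝ) ^ α) ^ s) n)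
      ((hM.integrable_comp _ n).const_mul _) ?_
    filter_upwards [hM.ae_one_le hr] with ω hω
    have hm : (0 : ℝ) < M n ω := by exact_mod_cast hω n ((le_max_right a 1).trans hn)
    have hp := linProd_pos (hs.pos_rank hr) (M n ω)
    have h2 : (linProd (fun k => (r k : ℝ)) (α * s) a (M n ω) * (M n ω : ℝ) ^ (-s))⁻¹ ≤ K₁ :=
      hK₁ ⟨M n ω, rfl⟩
    rw [Real.rpow_neg hm.le, ← div_eq_mul_inv, inv_div, div_le_iff₀ hp] at h2
    show ((M n ω : ℝ) / (n : ℝ) ^ α) ^ s ≤ _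
    rw [Real.div_rpow hm.le (Real.rpow_nonneg hn1.le _), ← Real.rpow_mul hn1.le,
      Real.rpow_neg hn1.le, div_eq_mul_inv, mul_right_comm]
    exact mul_le_mul_of_nonneg_right h2 (inv_nonneg.2 (Real.rpow_nonneg hn1.le _))
  refine h1.trans ?_
  rw [integral_const_mul, hM.integral_linProd hr.one_le (fun k hk => hs.rank_eq k hk.le) _ hna,
    mul_assoc]
  refine mul_le_mul_of_nonneg_left ?_ hK₁0
  have := hK₂ ⟨n, rfl⟩
  simp only [one_mul] at this
  rwa [mul_comm]

end Moments

/-! ### Almost sure convergence and positivity of the limit. -/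

section Limits

variable {Ω : Type*} [MeasurableSpace Ω] {P : Measure Ω} [IsProbabilityMeasure P]

/-- The convergence of the expectations under a bound on the moments of order `p > 1`. -/
lemma tendsto_integral_of_moment_le {f : ℕ → Ω → ℂ} {g : Ω → ℂ} (hf : ∀ n, AEStronglyMeasurable (f n) P)
    (hfg : ∀ᵐ ω ∂P, Tendsto (fun n => f n ω) atTop (𝓝 (g ω))) {p K : ℝ} (hp : 1 < p)
    (hint : ∀ n, Integrable (fun ω => ‖f n ω‖ ^ p) P) (hK : ∀ n, ∫ ω, ‖f n ω‖ ^ p ∂P ≤ K) :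
    Integrable g P ∧ Tendsto (fun n => ∫ ω, f n ω ∂P) atTop (𝓝 (∫ ω, g ω ∂P)) := by
  have hK0 : 0 ≤ K := (integral_nonneg fun ω => Real.rpow_nonneg (norm_nonneg _) _).trans (hK 0)
  have hui : UniformIntegrable f 1 P := by
    refine uniformIntegrable_of le_rfl ENNReal.one_ne_top hf fun ε hε => ?_
    -- On `‖f‖ ≥ C` one has `‖f‖ ≤ C ^ (1 - p) * ‖f‖ ^ p`, so the tails are uniformly small.
    have hlim : Tendsto (fun C : ℝ => C ^ (-(p - 1)) * K) atTop (𝓝 0) := by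
      simpa using (tendsto_rpow_neg_atTop (by linarith : 0 < p - 1)).mul_const K
    obtain ⟨C, hCε, hC0⟩ := ((hlim.eventually (ge_mem_nhds hε)).and (eventually_gt_atTop 0)).exists
    refine ⟨⟨C, hC0.le⟩, fun n => ?_⟩
    rw [eLpNorm_one_eq_lintegral_enorm]
    calc ∫⁻ ω, ‖{x | (⟨C, hC0.le⟩ : NNReal) ≤ ‖f n x‖₊}.indicator (f n) ω‖ₑ ∂P
        ≤ ∫⁻ ω, ENNReal.ofReal (C ^ (-(p - 1)) * ‖f n ω‖ ^ p) ∂P := by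
          refine lintegral_mono fun ω => ?_
          by_cases h : ω ∈ {x | (⟨C, hC0.le⟩ : NNReal) ≤ ‖f n x‖₊}
          · rw [Set.indicator_of_mem h, ← ofReal_norm]
            apply ENNReal.ofReal_le_ofReal
            have h' : C ≤ ‖f n ω‖ := h
            have h0 : 0 < ‖f n ω‖ := hC0.trans_le h'
            calc ‖f n ω‖ = ‖f n ω‖ ^ (-(p - 1)) * ‖f n ω‖ ^ p := by
                  rw [← Real.rpow_add h0]
                  simp
              _ ≤ C ^ (-(p - 1)) * ‖f n ω‖ ^ p := by
                  refine mul_le_mul_of_nonneg_right ?_ (Real.rpow_nonneg h0.le _)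
                  exact Real.rpow_le_rpow_of_nonpos hC0 h' (by linarith)
          · rw [Set.indicator_of_notMem h]
            simp
      _ = ENNReal.ofReal (∫ ω, C ^ (-(p - 1)) * ‖f n ω‖ ^ p ∂P) := by
          rw [ofReal_integral_eq_lintegral_ofReal ((hint n).const_mul _)]
          exact Eventually.of_forall fun ω =>
            mul_nonneg (Real.rpow_nonneg hC0.le _) (Real.rpow_nonneg (norm_nonneg _) _)
      _ ≤ ENNReal.ofReal ε := by
          apply ENNReal.ofReal_le_ofReal
          rw [integral_const_mul]
          exact (mul_le_mul_of_nonneg_left (hK n) (Real.rpow_nonneg hC0.le _)).trans hCε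
  have hg : MemLp g 1 P := hui.memLp_of_ae_tendsto hfg
  refine ⟨memLp_one_iff_integrable.1 hg, ?_⟩
  refine tendsto_integral_of_L1' g hg.1
    (Eventually.of_forall fun n => memLp_one_iff_integrable.1 (hui.memLp n)) ?_
  exact tendsto_Lp_finite_of_tendsto_ae le_rfl ENNReal.one_ne_top hf hg hui.2.1 hfg

variable {ℱ : Filtration ℕ (inferInstance : MeasurableSpace Ω)} {M : ℕ → Ω → ℕ} {r : ℕ → ℕ} {α : ℝ}

lemma admissibleExponent_zero {r : ℕ → ℕ} (hr : IsRankFunction r) {s : ℝ} (hs : -1 < α * s) :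
    AdmissibleExponent r α 0 s where
  rank_eq k hk := by
    obtain rfl : k = 0 := by omega
    exact hr.1
  lt := by simpa using hs

/-- The case `l = 1`: the growth factor `1 + 1 / (n + 1) = (n + 2) / (n + 1)` telescopes against the
denominator. -/
lemma IsHiringChain.martingale (hM : IsHiringChain r P ℱ M) (hr : IsRankFunction r) :
    Martingale (fun n ω => linProd (fun k => (r k : ℝ)) (1 : ℝ) 0 (M n ω) / ((n : ℝ) + 1)) ℱ P := by
  refine martingale_of_setIntegral_eq_succ ?_ ?_ ?_
  · intro n
    exact ((measurable_from_top (f := fun m => linProd (fun k => (r k : ℝ)) (1 : ℝ) 0 m /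
      ((n : ℝ) + 1))).comp (hM.measurable_filtration n)).stronglyMeasurable
  · intro n
    exact (hM.integrable_comp _ n).div_const _
  · intro n A hA
    rw [integral_div, integral_div, hM.setIntegral_linProd_succ hr.one_le (by simp) _ n.zero_le hA]
    push_cast
    field_simp

lemma IsHiringChain.ae_exists_tendsto_linProd (hM : IsHiringChain r P ℱ M)
    (hr : IsRankFunction r) : ∀ᵐ ω ∂P, ∃ L, Tendsto
      (fun n => linProd (fun k => (r k : ℝ)) (1 : ℝ) 0 (M n ω) / ((n : ℝ) + 1)) atTop (𝓝 L) := by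
  refine (hM.martingale hr).submartingale.exists_ae_tendsto_of_bdd (R := 1) fun n => ?_
  have hpos : ∀ m, 0 ≤ linProd (fun k => (r k : ℝ)) (1 : ℝ) 0 m :=
    fun m => Finset.prod_nonneg fun k _ => by
      simp only [RCLike.ofReal_real_eq_id, id]
      positivity
  rw [eLpNorm_one_eq_lintegral_enorm, ← ofReal_integral_norm_eq_lintegral_enorm
    ((hM.martingale hr).integrable n)]
  have h : ∫ ω, ‖linProd (fun k => (r k : ℝ)) (1 : ℝ) 0 (M n ω) / ((n : ℝ) + 1)‖ ∂P =
      ∫ ω, linProd (fun k => (r k : ℝ)) (1 : ℝ) 0 (M n ω) / ((n : ℝ) + 1) ∂P :=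
    integral_congr_ae (Eventually.of_forall fun ω =>
      Real.norm_of_nonneg (div_nonneg (hpos _) (by positivity)))
  rw [h, ← setIntegral_univ, ← (hM.martingale hr).setIntegral_eq n.zero_le MeasurableSet.univ]
  simp [hM.zero, linProd]

/-- Almost surely `M n / n ^ α` does not tend to `0`. -/
lemma IsHiringChain.ae_not_tendsto_zero (hM : IsHiringChain r P ℱ M) (hr : IsRankFunction r)
    (hα : 0 < α) (hq : RoughlyLinearSeq (fun k => (r k : ℝ)) α) :
    ∀ᵐ ω ∂P, ¬ Tendsto (fun n : ℕ => (M n ω : ℝ) / (n : ℝ) ^ α) atTop (𝓝 0) := by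
  -- A negative exponent with `α s = -1/2 > -1`, hence admissible from `a = 0` whatever `r` is.
  set s : ℝ := -(1 / (2 * α))
  have hs0 : s < 0 := neg_neg_of_pos (by positivity)
  have hs : AdmissibleExponent r α 0 s := admissibleExponent_zero hr (by
    have : α * s = -(1 / 2) := by simp only [s]; field_simp
    rw [this]; norm_num)
  obtain ⟨K, hK⟩ := hM.exists_moment_le hr hα hq hs
  have hmeas : ∀ n : ℕ, Measurable fun ω => ENNReal.ofReal (((M n ω : ℝ) / (n : ℝ) ^ α) ^ s) :=
    fun n => (measurable_from_top (f := fun m : ℕ =>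
      ENNReal.ofReal (((m : ℝ) / (n : ℝ) ^ α) ^ s))).comp (hM.measurable n)
  have hfatou : ∫⁻ ω, liminf (fun n : ℕ => ENNReal.ofReal (((M n ω : ℝ) / (n : ℝ) ^ α) ^ s)) atTop ∂P
      ≤ ENNReal.ofReal K := by
    refine (lintegral_liminf_le hmeas).trans ?_
    refine (liminf_le_liminf (v := fun _ => ENNReal.ofReal K) ?_).trans (by simp)
    filter_upwards [eventually_ge_atTop 1] with n hn
    rw [← ofReal_integral_eq_lintegral_ofReal
      (hM.integrable_comp (fun m => ((m : ℝ) / (n : ℝ) ^ α) ^ s) n)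
      (Eventually.of_forall fun ω => by positivity)]
    exact ENNReal.ofReal_le_ofReal (hK n (by simpa using hn))
  have hfin := ae_lt_top (Measurable.liminf hmeas) (hfatou.trans_lt ENNReal.ofReal_lt_top).ne
  filter_upwards [hfin, hM.ae_one_le hr] with ω hω h1 hlim
  have h2 : Tendsto (fun n : ℕ => (M n ω : ℝ) / (n : ℝ) ^ α) atTop (𝓝[>] 0) := by
    refine tendsto_nhdsWithin_iff.2 ⟨hlim, ?_⟩
    filter_upwards [eventually_ge_atTop 1] with n hn
    have : (0 : ℝ) < M n ω := by exact_mod_cast h1 n hn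
    have hn' : (0 : ℝ) < n := by exact_mod_cast hn
    exact div_pos this (Real.rpow_pos_of_pos hn' _)
  -- A zero limit would send the negative power to infinity, against the a.s. finite liminf provided
  -- by Fatou.
  have h3 := ENNReal.tendsto_ofReal_nhds_top.2 ((tendsto_rpow_neg_nhdsGT_zero hs0).comp h2)
  exact hω.ne h3.liminf_eq

/-- The almost sure limit of `M n / n ^ α`. -/
lemma IsHiringChain.exists_limit (hM : IsHiringChain r P ℱ M) (hr : IsRankFunction r)
    (hα : 0 < α) (hq : RoughlyLinearSeq (fun k => (r k : ℝ)) α) :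
    ∃ W : Ω → ℝ, Measurable W ∧ (∀ᵐ ω ∂P, 0 < W ω) ∧
      (∀ᵐ ω ∂P, Tendsto (fun n : ℕ => (M n ω : ℝ) / (n : ℝ) ^ α) atTop (𝓝 (W ω))) ∧
      ∀ᵐ ω ∂P, Tendsto (fun n => M n ω) atTop atTop := by
  have hA : AdmissibleExponent r α 0 (1 / α) := admissibleExponent_zero hr (by
    rw [mul_one_div_cancel hα.ne']; norm_num)
  obtain ⟨C, hC, hCt⟩ := hq.tendsto_linProd_real hα (1 / α) 0 (hA.pos_rank hr)
  rw [mul_one_div_cancel hα.ne'] at hCt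
  have hmain : ∀ᵐ ω ∂P, Tendsto (fun n => M n ω) atTop atTop ∧
      ∃ y : ℝ, Tendsto (fun n : ℕ => (M n ω : ℝ) / (n : ℝ) ^ α) atTop (𝓝 y) := by
    filter_upwards [hM.ae_exists_tendsto_linProd hr, hM.ae_not_tendsto_zero hr hα hq,
      hM.ae_one_le hr] with ω ⟨L, hL⟩ h0 h1
    have hinf : Tendsto (fun n => M n ω) atTop atTop := by
      rcases tendsto_atTop_of_monotone (hM.monotone ω) with h | ⟨l, hl⟩
      · exact h
      · refine absurd ?_ h0
        have hl' : Tendsto (fun n => (M n ω : ℝ)) atTop (𝓝 (l : ℝ)) :=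
          (continuous_of_discreteTopology (f := fun m : ℕ => (m : ℝ))).tendsto l |>.comp hl
        exact hl'.div_atTop ((tendsto_rpow_atTop hα).comp tendsto_natCast_atTop_atTop)
    -- The product at `M n` is `~ C * (M n) ^ (1 / α)` and `~ L * n`, so `(M n) ^ (1 / α) / n` tends
    -- to `L / C`.
    refine ⟨hinf, (L / C) ^ α, ?_⟩
    have h2 : Tendsto (fun n : ℕ => ((n : ℝ) + 1) / n) atTop (𝓝 1) := by
      have : Tendsto (fun n : ℕ => 1 + 1 / (n : ℝ)) atTop (𝓝 (1 + 0)) :=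
        tendsto_const_nhds.add tendsto_one_div_atTop_nhds_zero_nat
      rw [add_zero] at this
      refine this.congr' ?_
      filter_upwards [eventually_ge_atTop 1] with n hn
      have hn' : (n : ℝ) ≠ 0 := by positivity
      field_simp
    have h3 := ((hL.mul h2).div (hCt.comp hinf) hC.ne').rpow_const (p := α) (Or.inr hα.le)
    rw [mul_one] at h3
    refine h3.congr' ?_
    filter_upwards [eventually_ge_atTop 1] with n hn
    have hm : (0 : ℝ) < M n ω := by exact_mod_cast h1 n hn
    have hn' : (0 : ℝ) < n := by exact_mod_cast hn
    have hp : 0 < linProd (fun k => (r k : ℝ)) (1 : ℝ) 0 (M n ω) := by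
      have := linProd_pos (hA.pos_rank hr) (M n ω)
      rwa [mul_one_div_cancel hα.ne'] at this
    have e : linProd (fun k => (r k : ℝ)) (1 : ℝ) 0 (M n ω) / ((n : ℝ) + 1) * (((n : ℝ) + 1) / n) /
        (linProd (fun k => (r k : ℝ)) (1 : ℝ) 0 (M n ω) * (M n ω : ℝ) ^ (-(1 / α))) =
        (M n ω : ℝ) ^ (1 / α) / n := by
      rw [Real.rpow_neg hm.le]
      have := (Real.rpow_pos_of_pos hm (1 / α)).ne'
      field_simp
    simp only [Pi.div_apply, Function.comp_apply]
    rw [e, Real.div_rpow (by positivity) hn'.le, ← Real.rpow_mul hm.le,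
      one_div_mul_cancel hα.ne', Real.rpow_one]
  obtain ⟨W, hW, hWt⟩ := measurable_limit_of_tendsto_metrizable_ae (L := atTop)
    (f := fun (n : ℕ) ω => (M n ω : ℝ) / (n : ℝ) ^ α)
    (fun n => ((measurable_from_top (f := fun m : ℕ => (m : ℝ) / (n : ℝ) ^ α)).comp
      (hM.measurable n)).aemeasurable) (hmain.mono fun ω h => h.2)
  refine ⟨W, hW, ?_, hWt, hmain.mono fun ω h => h.1⟩
  filter_upwards [hWt, hM.ae_not_tendsto_zero hr hα hq] with ω h1 h2
  refine lt_of_le_of_ne (ge_of_tendsto' h1 fun n => by positivity) fun h => h2 (h ▸ h1)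

end Limits

/-! ### Convergence and evaluation of complex moments. -/

lemma ofReal_cpow_eq_exp {x : ℝ} (hx : 0 < x) (s : ℂ) :
    (x : ℂ) ^ s = Complex.exp (Real.log x * s) := by
  rw [Complex.cpow_def_of_ne_zero (by exact_mod_cast hx.ne'), Complex.ofReal_log hx.le]

lemma natCast_cpow_eq_exp {n : ℕ} (hn : 1 ≤ n) (s : ℂ) :
    (n : ℂ) ^ s = Complex.exp (Real.log n * s) := by
  have := ofReal_cpow_eq_exp (x := (n : ℝ)) (by exact_mod_cast hn) s
  simpa using this

lemma div_rpow_cpow {m n : ℕ} (hm : 1 ≤ m) (hn : 1 ≤ n) (α : ℝ) (s : ℂ) :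
    (((m : ℝ) / (n : ℝ) ^ α : ℝ) : ℂ) ^ s = (m : ℂ) ^ s * (n : ℂ) ^ (-((α : ℂ) * s)) := by
  have hm' : (0 : ℝ) < m := by exact_mod_cast hm
  have hn' : (0 : ℝ) < n := by exact_mod_cast hn
  rw [ofReal_cpow_eq_exp (by positivity), natCast_cpow_eq_exp hm, natCast_cpow_eq_exp hn,
    ← Complex.exp_add, Real.log_div hm'.ne' (by positivity), Real.log_rpow hn']
  congr 1
  push_cast
  ring

/-- Admissibility is an open condition on the exponent; the room left gives a bounded moment of
order `p > 1`, hence uniform integrability. -/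
lemma AdmissibleExponent.exists_one_lt {r : ℕ → ℕ} {α s : ℝ} {a : ℕ}
    (h : AdmissibleExponent r α a s) : ∃ p > 1, AdmissibleExponent r α a (s * p) := by
  have hc : Tendsto (fun p : ℝ => α * (s * p)) (𝓝[>] 1) (𝓝 (α * (s * 1))) :=
    (Continuous.tendsto (by fun_prop) 1).mono_left nhdsWithin_le_nhds
  rw [mul_one] at hc
  obtain ⟨p, hp, hp1⟩ := ((hc.eventually (lt_mem_nhds h.lt)).and self_mem_nhdsWithin).exists
  exact ⟨p, hp1, h.rank_eq, hp⟩

section Limits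

variable {Ω : Type*} [MeasurableSpace Ω] {P : Measure Ω} [IsProbabilityMeasure P]
  {ℱ : Filtration ℕ (inferInstance : MeasurableSpace Ω)} {M : ℕ → Ω → ℕ} {r : ℕ → ℕ} {α : ℝ}
  {W : Ω → ℝ}

/-- The convergence of complex moments, with a convergent weight. -/
lemma IsHiringChain.tendsto_integral_mul (hM : IsHiringChain r P ℱ M) (hr : IsRankFunction r)
    (hα : 0 < α) (hq : RoughlyLinearSeq (fun k => (r k : ℝ)) α)
    (hW0 : ∀ᵐ ω ∂P, 0 < W ω)
    (hW : ∀ᵐ ω ∂P, Tendsto (fun n : ℕ => (M n ω : ℝ) / (n : ℝ) ^ α) atTop (𝓝 (W ω)))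
    (hinf : ∀ᵐ ω ∂P, Tendsto (fun n => M n ω) atTop atTop)
    {s : ℂ} {a : ℕ} (hs : AdmissibleExponent r α a s.re) {c : ℕ → ℂ} {c₀ : ℂ}
    (hc : Tendsto c atTop (𝓝 c₀)) :
    Integrable (fun ω => (W ω : ℂ) ^ s * c₀) P ∧
      Tendsto (fun n : ℕ => ∫ ω, (((M n ω : ℝ) / (n : ℝ) ^ α : ℝ) : ℂ) ^ s * c (M n ω) ∂P) atTop
        (𝓝 (∫ ω, (W ω : ℂ) ^ s * c₀ ∂P)) := by
  obtain ⟨p, hp, hsp⟩ := hs.exists_one_lt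
  obtain ⟨K, hK⟩ := hM.exists_moment_le hr hα hq hsp
  obtain ⟨B, hB⟩ := hc.norm.bddAbove_range
  have hB0 : 0 ≤ B := (norm_nonneg _).trans (hB ⟨0, rfl⟩)
  set N := max a 1
  rw [← tendsto_add_atTop_iff_nat N]
  refine tendsto_integral_of_moment_le (f := fun n ω =>
    (((M (n + N) ω : ℝ) / ((n + N : ℕ) : ℝ) ^ α : ℝ) : ℂ) ^ s * c (M (n + N) ω))
    (p := p) (K := B ^ p * K) ?_ ?_ hp ?_ ?_
  · exact fun n => (hM.integrable_comp (fun m =>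
      (((m : ℝ) / ((n + N : ℕ) : ℝ) ^ α : ℝ) : ℂ) ^ s * c m) (n + N)).aestronglyMeasurable
  · filter_upwards [hW0, hW, hinf] with ω h0 h1 h2
    refine (tendsto_add_atTop_iff_nat (f := fun n =>
      (((M n ω : ℝ) / (n : ℝ) ^ α : ℝ) : ℂ) ^ s * c (M n ω)) N).2 ?_
    refine Tendsto.mul ?_ (hc.comp h2)
    have h3 : ContinuousAt (fun z : ℂ => z ^ s) (W ω : ℂ) :=
      continuousAt_cpow_const (Complex.ofReal_mem_slitPlane.2 h0)
    exact h3.tendsto.comp ((Complex.continuous_ofReal.tendsto _).comp h1)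
  · exact fun n => hM.integrable_comp (fun m =>
      ‖(((m : ℝ) / ((n + N : ℕ) : ℝ) ^ α : ℝ) : ℂ) ^ s * c m‖ ^ p) (n + N)
  · intro n
    have hn : N ≤ n + N := by omega
    have hn1 : 1 ≤ n + N := (le_max_right a 1).trans hn
    refine le_trans ?_ (mul_le_mul_of_nonneg_left (hK (n + N) hn) (Real.rpow_nonneg hB0 p))
    rw [← integral_const_mul]
    refine integral_mono_ae (hM.integrable_comp (fun m =>
      ‖(((m : ℝ) / ((n + N : ℕ) : ℝ) ^ α : ℝ) : ℂ) ^ s * c m‖ ^ p) (n + N))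
      ((hM.integrable_comp (fun m =>
        ((m : ℝ) / ((n + N : ℕ) : ℝ) ^ α) ^ (s.re * p)) (n + N)).const_mul _) ?_
    filter_upwards [hM.ae_one_le hr] with ω hω
    have hm : (0 : ℝ) < M (n + N) ω := by exact_mod_cast hω (n + N) hn1
    have hn' : (0 : ℝ) < ((n + N : ℕ) : ℝ) := by exact_mod_cast hn1
    have hy : 0 < (M (n + N) ω : ℝ) / ((n + N : ℕ) : ℝ) ^ α := by positivity
    show ‖_‖ ^ p ≤ _
    rw [norm_mul, Complex.norm_cpow_eq_rpow_re_of_pos hy,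
      Real.mul_rpow (Real.rpow_nonneg hy.le _) (norm_nonneg _), ← Real.rpow_mul hy.le, mul_comm]
    exact mul_le_mul_of_nonneg_right
      (Real.rpow_le_rpow (norm_nonneg _) (hB ⟨_, rfl⟩) (by linarith)) (Real.rpow_nonneg hy.le _)

/-- The complex moments of the limit. -/
lemma IsHiringChain.integral_cpow_mul_eq (hM : IsHiringChain r P ℱ M) (hr : IsRankFunction r)
    (hα : 0 < α) (hq : RoughlyLinearSeq (fun k => (r k : ℝ)) α)
    (hW0 : ∀ᵐ ω ∂P, 0 < W ω)
    (hW : ∀ᵐ ω ∂P, Tendsto (fun n : ℕ => (M n ω : ℝ) / (n : ℝ) ^ α) atTop (𝓝 (W ω)))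
    (hinf : ∀ᵐ ω ∂P, Tendsto (fun n => M n ω) atTop atTop)
    {s : ℂ} {a : ℕ} (hs : AdmissibleExponent r α a s.re) {b : ℕ}
    (hb : ∀ k < b, r k = k + 1) {C D : ℂ}
    (hC : Tendsto (fun m : ℕ => linProd (fun k => (r k : ℝ)) (α * s) b m * (m : ℂ) ^ (-s))
      atTop (𝓝 C))
    (hD : Tendsto (fun n : ℕ => linProd (fun k => (k : ℝ) + 1) (α * s) b n *
      (n : ℂ) ^ (-(α * s))) atTop (𝓝 D)) :
    (∫ ω, (W ω : ℂ) ^ s ∂P) * C = D := by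
  -- The weight is the product times `m ^ (-s)`: it converges to `C`, and it cancels the power of `M
  -- n`, leaving the exactly known expectation of the product.
  have h := (hM.tendsto_integral_mul hr hα hq hW0 hW hinf hs hC).2
  rw [integral_mul_const] at h
  refine tendsto_nhds_unique h (hD.congr' ?_)
  filter_upwards [eventually_ge_atTop (max b 1)] with n hn
  have hn1 : 1 ≤ n := (le_max_right b 1).trans hn
  rw [← hM.integral_linProd hr.one_le hb _ ((le_max_left b 1).trans hn), ← integral_mul_const]
  refine integral_congr_ae ?_
  filter_upwards [hM.ae_one_le hr] with ω hω
  rw [div_rpow_cpow (hω n hn1) hn1, natCast_cpow_eq_exp (hω n hn1) s, natCast_cpow_eq_exp (hω n hn1) (-s)]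
  have : Complex.exp (Real.log (M n ω) * s) * Complex.exp (Real.log (M n ω) * -s) = 1 := by
    rw [← Complex.exp_add, mul_neg, add_neg_cancel, Complex.exp_zero]
  linear_combination (-(linProd (fun k => (r k : ℝ)) (α * s : ℂ) b (M n ω)) *
    (n : ℂ) ^ (-((α : ℂ) * s))) * this

end Limits

/-! ### Gamma functions and the infinite product. -/

lemma linProd_natCast_add_one_eq (z : ℂ) (n : ℕ) :
    linProd (fun k => (k : ℝ) + 1) z 1 (n + 2) * ((n + 2).factorial : ℂ) =
      ∏ j ∈ Finset.range (n + 1), (z + 2 + j) := by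
  induction n with
  | zero =>
    rw [linProd_succ _ _ le_rfl, linProd_self _ _ le_rfl]
    simp
    ring
  | succ n ih =>
    rw [Finset.prod_range_succ, ← ih, linProd_succ _ _ (by omega), Nat.factorial_succ (n + 2)]
    have : ((n : ℂ) + 1 + 2) ≠ 0 := by exact_mod_cast (by omega : n + 1 + 2 ≠ 0)
    have h2 : ((n : ℂ) + 2 + 1) ≠ 0 := by exact_mod_cast (by omega : n + 2 + 1 ≠ 0)
    push_cast
    field_simp
    ring

/-- Gauss's product formula for the Gamma function. -/
lemma tendsto_linProd_natCast_add_one {z : ℂ} (hz : ∀ m : ℕ, z + 2 ≠ -(m : ℂ)) :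
    Tendsto (fun n : ℕ => linProd (fun k => (k : ℝ) + 1) z 1 n * (n : ℂ) ^ (-z)) atTop
      (𝓝 (Complex.Gamma (z + 2))⁻¹) := by
  obtain ⟨D, hD, -⟩ := roughlyLinearSeq_natCast_add_one.tendsto_linProd one_pos z 1
  simp only [Complex.ofReal_one, one_mul] at hD
  have hΓ : Complex.Gamma (z + 2) ≠ 0 := Complex.Gamma_ne_zero hz
  have h1 := (Complex.GammaSeq_tendsto_Gamma (z + 2)).mul ((tendsto_add_atTop_iff_nat 2).2 hD)
  have hlog : Tendsto (fun n : ℕ => Real.log ((n : ℝ) + 2) - Real.log n) atTop (𝓝 0) :=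
    (Real.tendsto_log_comp_add_sub_log 2).comp tendsto_natCast_atTop_atTop
  -- Multiplied by Euler's sequence for `Γ(z + 2)`, the normalized product at `n + 2` collapses to
  -- `(n / (n + 2)) ^ (z + 2) * (n + 2) / (n + 1)`, which tends to `1`.
  have h2 : Tendsto (fun n : ℕ =>
      Complex.exp (-(z + 2) * ((Real.log ((n : ℝ) + 2) - Real.log n : ℝ) : ℂ)) *
        ((1 - 1 / ((n + 2 : ℕ) : ℝ) : ℝ) : ℂ)⁻¹) atTop
      (𝓝 (Complex.exp (-(z + 2) * ((0 : ℝ) : ℂ)) * ((1 - 0 : ℝ) : ℂ)⁻¹)) := by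
    refine Tendsto.mul ?_ (Tendsto.inv₀ ?_ (by simp))
    · exact (Complex.continuous_exp.tendsto _).comp
        (((Complex.continuous_ofReal.tendsto _).comp hlog).const_mul _)
    · refine (Complex.continuous_ofReal.tendsto _).comp (tendsto_const_nhds.sub ?_)
      exact (tendsto_add_atTop_iff_nat (f := fun n : ℕ => 1 / (n : ℝ)) 2).2
        tendsto_one_div_atTop_nhds_zero_nat
  simp only [Complex.ofReal_zero, mul_zero, Complex.exp_zero, sub_zero, Complex.ofReal_one,
    inv_one, mul_one] at h2
  have h3 : Complex.Gamma (z + 2) * D = 1 := by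
    refine tendsto_nhds_unique h1 (h2.congr' ?_)
    filter_upwards [eventually_ge_atTop 1] with n hn
    have hprod : ∏ j ∈ Finset.range (n + 1), (z + 2 + j) ≠ 0 :=
      Finset.prod_ne_zero_iff.2 fun j _ h => hz j (eq_neg_of_add_eq_zero_left h)
    have hl := linProd_natCast_add_one_eq z n
    have hf : ((n + 2).factorial : ℂ) = ((n : ℂ) + 2) * ((n : ℂ) + 1) * (n.factorial : ℂ) := by
      rw [Nat.factorial_succ, Nat.factorial_succ]
      push_cast
      ring
    have hf0 : (n.factorial : ℂ) ≠ 0 := by exact_mod_cast n.factorial_ne_zero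
    have hn1 : ((n : ℂ) + 1) ≠ 0 := by exact_mod_cast n.succ_ne_zero
    have hn2 : ((n : ℂ) + 2) ≠ 0 := by exact_mod_cast (by omega : n + 2 ≠ 0)
    have hl' : linProd (fun k => (k : ℝ) + 1) z 1 (n + 2) =
        (∏ j ∈ Finset.range (n + 1), (z + 2 + j)) /
          (((n : ℂ) + 2) * ((n : ℂ) + 1) * (n.factorial : ℂ)) := by
      rw [← hl, hf]
      field_simp
    rw [Complex.GammaSeq, hl', natCast_cpow_eq_exp hn, natCast_cpow_eq_exp (by omega : 1 ≤ n + 2)]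
    have e1 : ((1 - 1 / ((n + 2 : ℕ) : ℝ) : ℝ) : ℂ)⁻¹ = ((n : ℂ) + 2) / ((n : ℂ) + 1) := by
      have : ((1 - 1 / ((n + 2 : ℕ) : ℝ) : ℝ) : ℂ) = ((n : ℂ) + 1) / ((n : ℂ) + 2) := by
        push_cast
        field_simp
        ring
      rw [this, inv_div]
    have hpos : (0 : ℝ) < (n : ℝ) + 2 := by positivity
    have e2 : Complex.exp (-(z + 2) * ((Real.log ((n : ℝ) + 2) - Real.log n : ℝ) : ℂ)) =
        Complex.exp (Real.log n * (z + 2)) * Complex.exp (Real.log ((n + 2 : ℕ) : ℝ) * -z) /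
          ((n : ℂ) + 2) ^ 2 := by
      have : ((n : ℂ) + 2) ^ 2 = Complex.exp (Real.log ((n : ℝ) + 2) * 2) := by
        have h := ofReal_cpow_eq_exp hpos 2
        rw [← h]
        push_cast
        exact (Complex.cpow_ofNat _ 2).symm
      rw [this, ← Complex.exp_add, ← Complex.exp_sub]
      congr 1
      push_cast
      ring
    rw [e1, e2]
    field_simp
  rwa [eq_inv_of_mul_eq_one_right h3] at hD

lemma linProd_natCast_eq (s : ℂ) (n : ℕ) :
    linProd (fun k => (k : ℝ)) s 1 (n + 2) =
      (1 + s) * linProd (fun k => (k : ℝ) + 1) s 1 (n + 1) := by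
  induction n with
  | zero =>
    rw [linProd_succ _ _ le_rfl, linProd_self _ _ le_rfl, linProd_self _ _ le_rfl]
    simp
  | succ n ih =>
    rw [show n + 1 + 2 = n + 2 + 1 from rfl, linProd_succ _ s (by omega : 1 ≤ n + 2), ih,
      linProd_succ _ s (by omega : 1 ≤ n + 1)]
    push_cast
    ring

lemma tendsto_linProd_natCast {s : ℂ} (hs : ∀ m : ℕ, 1 ≤ m → s ≠ -(m : ℂ)) :
    Tendsto (fun n : ℕ => linProd (fun k => (k : ℝ)) s 1 n * (n : ℂ) ^ (-s)) atTop
      (𝓝 (Complex.Gamma (s + 1))⁻¹) := by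
  obtain ⟨D, hD, -⟩ := roughlyLinearSeq_natCast.tendsto_linProd one_pos s 1
  simp only [Complex.ofReal_one, one_mul] at hD
  have hz : ∀ m : ℕ, s + 2 ≠ -(m : ℂ) := fun m h => hs (m + 2) (by omega) (by
    push_cast
    linear_combination h)
  have hs1 : s + 1 ≠ 0 := fun h => hs 1 le_rfl (by
    push_cast
    linear_combination h)
  have h1 := (tendsto_add_atTop_iff_nat 1).2 (tendsto_linProd_natCast_add_one hz)
  have hlog : Tendsto (fun n : ℕ => Real.log (((n + 1 : ℕ) : ℝ) + 1) - Real.log ((n + 1 : ℕ) : ℝ))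
      atTop (𝓝 0) := by
    have h := (Real.tendsto_log_comp_add_sub_log 1).comp tendsto_natCast_atTop_atTop
    exact (tendsto_add_atTop_iff_nat (f := fun n : ℕ => Real.log ((n : ℝ) + 1) - Real.log n) 1).2 h
  have h2 : Tendsto (fun n : ℕ =>
      Complex.exp (-s * ((Real.log (((n + 1 : ℕ) : ℝ) + 1) - Real.log ((n + 1 : ℕ) : ℝ) : ℝ) : ℂ)))
      atTop (𝓝 (Complex.exp (-s * ((0 : ℝ) : ℂ)))) :=
    (Complex.continuous_exp.tendsto _).comp
      (((Complex.continuous_ofReal.tendsto _).comp hlog).const_mul _)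
  rw [Complex.ofReal_zero, mul_zero, Complex.exp_zero] at h2
  have h3 := (h1.const_mul (1 + s)).mul h2
  have h4 : D = (1 + s) * (Complex.Gamma (s + 2))⁻¹ * 1 := by
    refine tendsto_nhds_unique ((tendsto_add_atTop_iff_nat 2).2 hD) (h3.congr fun n => ?_)
    rw [linProd_natCast_eq, natCast_cpow_eq_exp (by omega : 1 ≤ n + 1),
      natCast_cpow_eq_exp (by omega : 1 ≤ n + 2), ← mul_assoc, mul_assoc _ (Complex.exp _),
      ← Complex.exp_add]
    congr 2
    push_cast
    ring_nf
  have h5 : Complex.Gamma (s + 2) = (s + 1) * Complex.Gamma (s + 1) := by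
    rw [← Complex.Gamma_add_one _ hs1]
    ring_nf
  rw [h4, h5, mul_one, mul_inv, add_comm 1 s, mul_inv_cancel_left₀ hs1] at hD
  exact hD

section Rank

variable {r : ℕ → ℕ} {α : ℝ}

/-- Otherwise the monotone `r` has a finite limit and the squares `(1 / r m) ^ 2` do not tend to
`0`. -/
lemma tendsto_rank_atTop (hr : IsRankFunction r)
    (hq : RoughlyLinearSeq (fun k => (r k : ℝ)) α) : Tendsto r atTop atTop := by
  rcases tendsto_atTop_of_monotone hr.monotone with h | ⟨l, hl⟩
  · exact h
  · exfalso
    have hl0 : (l : ℝ) ≠ 0 := by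
      have : 1 ≤ l := ge_of_tendsto' hl hr.one_le
      exact_mod_cast (by omega : l ≠ 0)
    have h1 : Tendsto (fun m => (r m : ℝ)) atTop (𝓝 (l : ℝ)) :=
      (continuous_of_discreteTopology (f := fun m : ℕ => (m : ℝ))).tendsto l |>.comp hl
    have h2 := ((h1.inv₀ hl0).pow 2)
    have h3 := hq.summable_sq.tendsto_atTop_zero
    simp only [one_div] at h3
    have h4 := tendsto_nhds_unique h3 ((tendsto_add_atTop_iff_nat 1).2 h2)
    exact (pow_ne_zero 2 (inv_ne_zero hl0)) h4.symm

/-- Steps of size at most one skip no value. This identifies the poles of `Γ(s α + 2)` with points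
excluded by `s α ≠ -r k`. -/
lemma exists_rank_eq (hr : IsRankFunction r) (ht : Tendsto r atTop atTop) {j : ℕ} (hj : 2 ≤ j) :
    ∃ k, 1 ≤ k ∧ r k = j := by
  classical
  have h : ∃ k, j ≤ r k := (ht.eventually_ge_atTop j).exists
  obtain ⟨k, hk⟩ : ∃ k, Nat.find h = k + 1 := by
    refine Nat.exists_eq_succ_of_ne_zero fun h0 => ?_
    have := Nat.find_spec h
    rw [h0, hr.1] at this
    omega
  refine ⟨k + 1, by omega, le_antisymm ?_ (hk ▸ Nat.find_spec h)⟩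
  have := Nat.find_min h (m := k) (by omega)
  exact (hr.2 k).2.trans (by omega)

/-- The product formula. -/
lemma multipliable_and_tprod (hr : IsRankFunction r) (hα : 0 < α)
    (hq : RoughlyLinear r α) {s : ℂ} {C : ℂ}
    (hs : ∀ k : ℕ, 1 ≤ k → s ≠ -(k : ℂ)) (hsr : ∀ k : ℕ, 1 ≤ k → s * α ≠ -(r k : ℂ))
    (hC : Tendsto (fun m : ℕ => linProd (fun k => (r k : ℝ)) (α * s) 1 m * (m : ℂ) ^ (-s))
      atTop (𝓝 C)) (hC0 : C ≠ 0) :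
    Multipliable (fun k : ℕ => (1 + s / ((k + 1 : ℕ) : ℂ)) / (1 + s * α / (r (k + 1) : ℂ))) ∧
      ∏' k : ℕ, (1 + s / ((k + 1 : ℕ) : ℂ)) / (1 + s * α / (r (k + 1) : ℂ)) =
        (Complex.Gamma (s + 1))⁻¹ / C := by
  have hq' : RoughlyLinearSeq (fun k => (r k : ℝ)) α := summable_abs_iff.1 hq
  have hr0 : ∀ k, (r k : ℂ) ≠ 0 := fun k => by
    have := hr.one_le k
    exact_mod_cast (by omega : r k ≠ 0)
  have hne : ∀ k, 1 + s * α / (r (k + 1) : ℂ) ≠ 0 := fun k h => by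
    refine hsr (k + 1) (by omega) ?_
    have := hr0 (k + 1)
    field_simp at h
    linear_combination h
  have hden : Tendsto (fun k : ℕ => 1 + s * α / (r (k + 1) : ℂ)) atTop (𝓝 1) := by
    have h1 : Tendsto (fun k : ℕ => ((r (k + 1) : ℂ))⁻¹) atTop (𝓝 0) :=
      tendsto_inv_atTop_nhds_zero_nat.comp
        (((tendsto_add_atTop_iff_nat 1).2 (tendsto_rank_atTop hr hq')))
    simpa [div_eq_mul_inv] using (h1.const_mul (s * α)).const_add 1
  have hsum : Summable fun k : ℕ =>
      ‖(1 + s / ((k + 1 : ℕ) : ℂ)) / (1 + s * α / (r (k + 1) : ℂ)) - 1‖ := by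
    -- Each factor minus `1` is `-s α (1 / r k - 1 / (α k))` over a denominator tending to `1`; the
    -- constant `2` comes from bounding that denominator below by `1/2`.
    refine Summable.of_norm_bounded_eventually_nat
      (g := fun k : ℕ => 2 * ‖s * α‖ * |1 / (r (k + 1) : ℝ) - 1 / (α * ((k : ℝ) + 1))|)
      (hq.mul_left _) ?_
    have h2 : ∀ᶠ k : ℕ in atTop, 1 / 2 < ‖1 + s * α / (r (k + 1) : ℂ)‖ := by
      refine hden.norm.eventually (lt_mem_nhds ?_)
      norm_num
    filter_upwards [h2] with k hk
    have hαC : (α : ℂ) ≠ 0 := by exact_mod_cast hα.ne'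
    have hk1 : ((k : ℂ) + 1) ≠ 0 := by exact_mod_cast k.succ_ne_zero
    have e : (1 + s / ((k + 1 : ℕ) : ℂ)) / (1 + s * α / (r (k + 1) : ℂ)) - 1 =
        -(s * α) * ((1 / (r (k + 1) : ℝ) - 1 / (α * ((k : ℝ) + 1)) : ℝ) : ℂ) /
          (1 + s * α / (r (k + 1) : ℂ)) := by
      rw [div_sub_one (hne k)]
      congr 1
      push_cast
      have := hr0 (k + 1)
      field_simp
      ring
    rw [norm_norm, e, norm_div, norm_mul, norm_neg, Complex.norm_real, Real.norm_eq_abs,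
      div_le_iff₀ (by linarith)]
    set x := |1 / (r (k + 1) : ℝ) - 1 / (α * ((k : ℝ) + 1))|
    have : 0 ≤ ‖s * α‖ * x := by positivity
    nlinarith
  have hmul : Multipliable (fun k : ℕ =>
      (1 + s / ((k + 1 : ℕ) : ℂ)) / (1 + s * α / (r (k + 1) : ℂ))) := by
    simpa using multipliable_one_add_of_summable hsum
  refine ⟨hmul, ?_⟩
  refine tendsto_nhds_unique hmul.hasProd.tendsto_prod_nat ?_
  have h3 := (tendsto_add_atTop_iff_nat 1).2 ((tendsto_linProd_natCast hs).div hC hC0)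
  refine h3.congr fun n => ?_
  have hn0 : ((n + 1 : ℕ) : ℂ) ^ (-s) ≠ 0 := by
    rw [natCast_cpow_eq_exp (by omega)]
    exact Complex.exp_ne_zero _
  rw [Pi.div_apply, mul_div_mul_right _ _ hn0, linProd, linProd, ← Finset.prod_div_distrib,
    Finset.prod_Ico_eq_prod_range, Nat.add_sub_cancel]
  refine Finset.prod_congr rfl fun k _ => ?_
  simp [add_comm, mul_comm]

end Rank

/-! ### Convergence of series of independent variables. -/

section IndepSeries

variable {Ω : Type*} [MeasurableSpace Ω] {μ : Measure Ω} [IsProbabilityMeasure μ] {f : ℕ → Ω → ℝ}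

/-- Kolmogorov's theorem on the convergence of a series of independent centered variables. -/
lemma ae_exists_tendsto_sum_of_iIndepFun (hf : ∀ i, Measurable (f i)) (hind : iIndepFun f μ)
    (hL2 : ∀ i, MemLp (f i) 2 μ) (h0 : ∀ i, ∫ ω, f i ω ∂μ = 0)
    (hV : Summable fun i => variance (f i) μ) :
    ∀ᵐ ω ∂μ, ∃ L, Tendsto (fun n => ∑ k ∈ Finset.range (n + 1), f k ω) atTop (𝓝 L) := by
  set ℱ := Filtration.natural f fun i => (hf i).stronglyMeasurable
  have hint : ∀ i, Integrable (f i) μ := fun i => (hL2 i).integrable one_le_two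
  have hmart : Martingale (fun n ω => ∑ k ∈ Finset.range (n + 1), f k ω) ℱ μ := by
    refine martingale_of_condExp_sub_eq_zero_nat ?_ ?_ ?_
    · intro n
      refine Finset.stronglyMeasurable_fun_sum _ fun k hk => ?_
      exact (Filtration.stronglyAdapted_natural (fun i => (hf i).stronglyMeasurable) k).mono
        (ℱ.mono (Finset.mem_range_succ_iff.1 hk))
    · exact fun n => integrable_finsetSum _ fun k _ => hint k
    · intro n
      have e : (fun ω => ∑ k ∈ Finset.range (n + 1 + 1), f k ω) -
          (fun ω => ∑ k ∈ Finset.range (n + 1), f k ω) = f (n + 1) := by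
        funext ω
        simp [Finset.sum_range_succ]
      rw [e]
      refine (hind.condExp_natural_ae_eq_of_lt (fun i => (hf i).stronglyMeasurable)
        n.lt_succ_self).trans ?_
      rw [h0]
      rfl
  refine hmart.submartingale.exists_ae_tendsto_of_bdd
    (R := (1 + ∑' i, variance (f i) μ).toNNReal) fun n => ?_
  have hS : MemLp (∑ k ∈ Finset.range (n + 1), f k) 2 μ := memLp_finsetSum' _ fun k _ => hL2 k
  have hvar : variance (∑ k ∈ Finset.range (n + 1), f k) μ ≤ ∑' i, variance (f i) μ := by
    rw [IndepFun.variance_sum (fun i _ => hL2 i) fun i _ j _ hij => hind.indepFun hij]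
    exact hV.sum_le_tsum _ fun i _ => variance_nonneg _ _
  have hmean : ∫ ω, (∑ k ∈ Finset.range (n + 1), f k) ω ∂μ = 0 := by
    simp only [Finset.sum_apply]
    rw [integral_finsetSum _ fun k _ => hint k]
    exact Finset.sum_eq_zero fun k _ => h0 k
  rw [variance_of_integral_eq_zero hS.aemeasurable hmean] at hvar
  rw [eLpNorm_one_eq_lintegral_enorm,
    ← ofReal_integral_norm_eq_lintegral_enorm (hmart.integrable n)]
  refine ENNReal.ofReal_le_ofReal ?_
  -- The martingale is bounded in `L¹` because `|x| ≤ 1 + x ^ 2` and the variances are summable.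
  have h1 : ∫ ω, ‖∑ k ∈ Finset.range (n + 1), f k ω‖ ∂μ ≤
      ∫ ω, (1 + (∑ k ∈ Finset.range (n + 1), f k) ω ^ 2) ∂μ := by
    refine integral_mono (hmart.integrable n).norm
      ((integrable_const _).add hS.integrable_sq) fun ω => ?_
    simp only [Finset.sum_apply, Real.norm_eq_abs]
    set x := ∑ k ∈ Finset.range (n + 1), f k ω
    nlinarith [sq_nonneg (|x| - 1), sq_abs x, abs_nonneg x]
  refine h1.trans ?_
  rw [integral_add (integrable_const _) hS.integrable_sq]
  simpa using hvar

end IndepSeries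

/-! ### The standard exponential law. -/

section Exponential

instance : IsProbabilityMeasure (expMeasure 1) := isProbabilityMeasure_expMeasure one_pos

lemma expMeasure_one_eq : expMeasure 1 =
    (volume.restrict (Set.Ioi 0)).withDensity fun x => ENNReal.ofReal (Real.exp (-x)) := by
  rw [restrict_Ioi_eq_restrict_Ici, ← withDensity_indicator measurableSet_Ici]
  show volume.withDensity (exponentialPDF 1) = _
  congr 1
  funext x
  rw [exponentialPDF_eq, Set.indicator_apply]
  by_cases h : 0 ≤ x <;> simp [h]

lemma integral_expMeasure_one {E : Type*} [NormedAddCommGroup E] [NormedSpace ℝ E] (f : ℝ → E) :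
    ∫ x, f x ∂(expMeasure 1) = ∫ x in Set.Ioi 0, Real.exp (-x) • f x := by
  rw [expMeasure_one_eq, integral_withDensity_eq_integral_toReal_smul (by fun_prop)
    (Eventually.of_forall fun _ => ENNReal.ofReal_lt_top)]
  simp [ENNReal.toReal_ofReal (Real.exp_pos _).le]

lemma integrable_pow_expMeasure_one (n : ℕ) : Integrable (fun x : ℝ => x ^ n) (expMeasure 1) := by
  rw [expMeasure_one_eq, integrable_withDensity_iff_integrable_smul' (by fun_prop)
    (Eventually.of_forall fun _ => ENNReal.ofReal_lt_top)]
  have h := Real.GammaIntegral_convergent (s := (n : ℝ) + 1) (by positivity)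
  refine h.congr_fun (fun x _ => ?_) measurableSet_Ioi
  simp [ENNReal.toReal_ofReal (Real.exp_pos _).le]

lemma integral_pow_expMeasure_one (n : ℕ) : ∫ x : ℝ, x ^ n ∂(expMeasure 1) = n.factorial := by
  rw [integral_expMeasure_one, ← Real.Gamma_nat_eq_factorial,
    Real.Gamma_eq_integral (by positivity)]
  simp

lemma charFun_expMeasure_one (t : ℝ) :
    ∫ x : ℝ, Complex.exp (t * x * Complex.I) ∂(expMeasure 1) = (1 - t * Complex.I)⁻¹ := by
  rw [integral_expMeasure_one]
  have h : ∀ x : ℝ, Real.exp (-x) • Complex.exp (t * x * Complex.I) =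
      Complex.exp ((t * Complex.I - 1) * x) := fun x => by
    rw [Complex.real_smul, Complex.ofReal_exp, ← Complex.exp_add]
    congr 1
    push_cast
    ring
  simp only [h]
  rw [integral_exp_mul_complex_Ioi (by simp)]
  rw [Complex.ofReal_zero, mul_zero, Complex.exp_zero, ← neg_sub 1 ((t : ℂ) * Complex.I), neg_div_neg_eq,
    one_div]

end Exponential

/-! ### The series `Z` and its characteristic function. -/

section ZSeries

/-- The coefficients of the series `Z`. -/
noncomputable def zCoeff (r : ℕ → ℕ) (k : ℕ) : ℝ :=
  if 1 ≤ k ∧ r k = r (k - 1) then 1 / (r k : ℝ) else 0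

lemma zPartial_eq (r : ℕ → ℕ) (e : ℕ → ℝ) (m : ℕ) :
    zPartial r e m = ∑ k ∈ Finset.range (m + 1), zCoeff r k * (e k - 1) := by
  induction m with
  | zero => simp [zPartial, zCoeff]
  | succ m ih =>
    rw [Finset.sum_range_succ, ← ih, zPartial, zPartial,
      Finset.sum_Icc_succ_top (by omega : 1 ≤ m + 1)]
    congr 1
    simp only [zCoeff, le_add_iff_nonneg_left, zero_le, true_and]
    split_ifs <;> ring

instance : IsProbabilityMeasure iidExp := by
  unfold iidExp
  infer_instance

lemma integral_iidExp_eval {E : Type*} [NormedAddCommGroup E] [NormedSpace ℝ E] {g : ℝ → E}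
    (hg : StronglyMeasurable g) (k : ℕ) : ∫ e, g (e k) ∂iidExp = ∫ x, g x ∂(expMeasure 1) := by
  have h : iidExp.map (fun e => e k) = expMeasure 1 := Measure.infinitePi_map_eval _ k
  rw [← h, integral_map (measurable_pi_apply k).aemeasurable hg.aestronglyMeasurable]

lemma measurable_const_mul_eval_sub_one (c : ℝ) (k : ℕ) :
    Measurable fun e : ℕ → ℝ => c * (e k - 1) := by
  fun_prop

lemma measurable_zPartial (r : ℕ → ℕ) (m : ℕ) : Measurable fun e => zPartial r e m := by
  simp only [zPartial_eq]
  exact Finset.measurable_sum _ fun k _ => measurable_const_mul_eval_sub_one _ k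

lemma iIndepFun_iidExp (w : ℕ → ℝ) : iIndepFun (fun k (e : ℕ → ℝ) => w k * (e k - 1)) iidExp :=
  iIndepFun_infinitePi (X := fun k (x : ℝ) => w k * (x - 1)) fun k => by fun_prop

lemma memLp_sub_one : MemLp (fun x : ℝ => x - 1) 2 (expMeasure 1) := by
  refine MemLp.sub ?_ (memLp_const 1)
  exact (memLp_two_iff_integrable_sq aestronglyMeasurable_id).2 (integrable_pow_expMeasure_one 2)

lemma integral_sub_one : ∫ x : ℝ, (x - 1) ∂(expMeasure 1) = 0 := by
  have h1 := integrable_pow_expMeasure_one 1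
  have h2 := integral_pow_expMeasure_one 1
  simp only [pow_one] at h1 h2
  rw [integral_sub h1 (integrable_const _), h2]
  simp

lemma memLp_iidExp (c : ℝ) (k : ℕ) : MemLp (fun e : ℕ → ℝ => c * (e k - 1)) 2 iidExp :=
  (memLp_sub_one.comp_measurePreserving (measurePreserving_eval_infinitePi _ k)).const_mul c

lemma integral_iidExp_mul_sub_one (c : ℝ) (k : ℕ) : ∫ e, c * (e k - 1) ∂iidExp = 0 := by
  rw [integral_const_mul, integral_iidExp_eval (g := fun x => x - 1) (by fun_prop),
    integral_sub_one, mul_zero]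

lemma variance_iidExp (c : ℝ) (k : ℕ) :
    variance (fun e : ℕ → ℝ => c * (e k - 1)) iidExp = c ^ 2 * variance (fun x => x - 1) (expMeasure 1) := by
  rw [variance_const_mul, variance_of_integral_eq_zero
      ((measurable_pi_apply k).sub_const 1).aemeasurable ?_,
    variance_of_integral_eq_zero (by fun_prop) integral_sub_one,
    integral_iidExp_eval (g := fun x : ℝ => (x - 1) ^ 2) (by fun_prop)]
  simpa using integral_iidExp_mul_sub_one 1 k

lemma summable_zCoeff_sq {r : ℕ → ℕ} {α : ℝ} (hq : RoughlyLinearSeq (fun k => (r k : ℝ)) α) :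
    Summable fun k => zCoeff r k ^ 2 := by
  rw [← summable_nat_add_iff 1]
  refine hq.summable_sq.of_nonneg_of_le (fun _ => sq_nonneg _) fun k => ?_
  rw [zCoeff]
  split_ifs
  · exact le_rfl
  · rw [zero_pow two_ne_zero]
    exact sq_nonneg _

lemma exists_tendsto_zPartial {r : ℕ → ℕ} {α : ℝ}
    (hq : RoughlyLinearSeq (fun k => (r k : ℝ)) α) :
    ∃ Z : (ℕ → ℝ) → ℝ, Measurable Z ∧
      ∀ᵐ e ∂iidExp, Tendsto (zPartial r e) atTop (𝓝 (Z e)) := by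
  have h := ae_exists_tendsto_sum_of_iIndepFun (μ := iidExp)
    (f := fun k (e : ℕ → ℝ) => zCoeff r k * (e k - 1)) (fun k => by fun_prop)
    (iIndepFun_iidExp _) (fun k => memLp_iidExp _ k) (fun k => integral_iidExp_mul_sub_one _ k)
    (by
      simp only [variance_iidExp]
      exact (summable_zCoeff_sq hq).mul_right _)
  refine measurable_limit_of_tendsto_metrizable_ae (f := fun m e => zPartial r e m)
    (fun m => ?_) ?_
  · exact (measurable_zPartial r m).aemeasurable
  · simpa only [zPartial_eq] using h

/-- The characteristic function of the partial sums. -/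
lemma integral_exp_zPartial (r : ℕ → ℕ) (t : ℝ) (m : ℕ) :
    ∫ e, Complex.exp (t * zPartial r e m * Complex.I) ∂iidExp =
      ∏ k ∈ Finset.range (m + 1), Complex.exp (-(t * Complex.I) * zCoeff r k) /
        (1 + -(t * Complex.I) * zCoeff r k) := by
  have h := congrFun (iIndepFun.charFun_map_fun_finsetSum_eq_prod (P := iidExp)
    (s := Finset.range (m + 1)) (X := fun k (e : ℕ → ℝ) => zCoeff r k * (e k - 1))
    (fun k _ => (measurable_const_mul_eval_sub_one _ k).aemeasurable)
    ((iIndepFun_iidExp (zCoeff r)).precomp (g := ((↑) : Finset.range (m + 1) → ℕ))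
      Subtype.val_injective)) t
  rw [charFun_apply_real, integral_map (Finset.measurable_sum _ fun k _ =>
    measurable_const_mul_eval_sub_one _ k).aemeasurable (by fun_prop), Finset.prod_apply] at h
  simp only [zPartial_eq]
  rw [h]
  refine Finset.prod_congr rfl fun k _ => ?_
  rw [charFun_apply_real, integral_map (measurable_const_mul_eval_sub_one _ k).aemeasurable
    (by fun_prop)]
  have e1 : ∀ e : ℕ → ℝ, Complex.exp (t * (zCoeff r k * (e k - 1) : ℝ) * Complex.I) =
      Complex.exp (-(t * Complex.I) * zCoeff r k) *
        Complex.exp ((t * zCoeff r k : ℝ) * (e k) * Complex.I) := fun e => by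
    rw [← Complex.exp_add]
    congr 1
    push_cast
    ring
  simp only [e1]
  rw [integral_const_mul, integral_iidExp_eval
    (g := fun x : ℝ => Complex.exp ((t * zCoeff r k : ℝ) * x * Complex.I)) (by fun_prop),
    charFun_expMeasure_one, div_eq_mul_inv]
  push_cast
  ring_nf

/-- Each index in `1, …, m` either repeats the previous value, and then appears through `zCoeff`, or
introduces a new one; the new values are `2, …, r m`, each once. Non-repeated indices have
coefficient `0`, where `φ` is `1`. -/
lemma prod_zCoeff {r : ℕ → ℕ} (hr : IsRankFunction r) (φ : ℝ → ℂ) (h0 : φ 0 = 1) (m : ℕ) :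
    (∏ k ∈ Finset.range (m + 1), φ (zCoeff r k)) *
      ∏ j ∈ Finset.Ico 1 (r m), φ (1 / ((j : ℝ) + 1)) =
    ∏ k ∈ Finset.Ico 1 (m + 1), φ (1 / (r k : ℝ)) := by
  induction m with
  | zero => simp [zCoeff, hr.1, h0]
  | succ m ih =>
    rw [Finset.prod_range_succ, Finset.prod_Ico_succ_top (by omega : 1 ≤ m + 1), ← ih]
    by_cases h : r (m + 1) = r m
    · have : zCoeff r (m + 1) = 1 / (r (m + 1) : ℝ) := by simp [zCoeff, h]
      rw [this, h]
      ring
    · have h1 : r (m + 1) = r m + 1 := by have := hr.2 m; omega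
      have h2 : zCoeff r (m + 1) = 0 := by simp [zCoeff, h]
      rw [h2, h0, h1, Finset.prod_Ico_succ_top (hr.one_le m)]
      push_cast
      ring

/-- A telescoping sum: the analogue of `ρ` for the sequence `k + 1`, and the source of the factor
`e^{-α}` in the law of `W`. -/
lemma tsum_one_div_add_two :
    ∑' m : ℕ, (1 / (((m + 1 : ℕ) : ℝ) + 1) - 1 / (1 * ((m : ℝ) + 1))) = -1 := by
  have hs := roughlyLinearSeq_natCast_add_one
  refine tendsto_nhds_unique hs.hasSum.tendsto_sum_nat ?_
  have h : ∀ N : ℕ, ∑ m ∈ Finset.range N, (1 / (((m + 1 : ℕ) : ℝ) + 1) - 1 / (1 * ((m : ℝ) + 1))) =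
      1 / ((N : ℝ) + 1) - 1 := by
    intro N
    have := Finset.sum_range_sub (fun m : ℕ => 1 / ((m : ℝ) + 1)) N
    simpa using this
  simp only [h]
  simpa using (tendsto_one_div_add_atTop_nhds_zero_nat (𝕜 := ℝ)).sub_const 1

/-- Inserting `m ^ (-s)` above and below makes numerator and denominator converge separately. -/
lemma prod_exp_div_linProd (q : ℕ → ℝ) {α : ℝ} (hα : α ≠ 0) (s : ℂ) {m : ℕ} (hm : 1 ≤ m) :
    ∏ k ∈ Finset.Ico 1 m, Complex.exp (α * s * (1 / q k : ℝ)) / (1 + α * s * (1 / q k : ℝ)) =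
      Complex.exp (α * s * ((∑ k ∈ Finset.Ico 1 m, 1 / q k - Real.log m / α : ℝ) : ℂ)) /
        (linProd q (α * s) 1 m * (m : ℂ) ^ (-s)) := by
  have hα' : (α : ℂ) ≠ 0 := by exact_mod_cast hα
  rw [Finset.prod_div_distrib, ← Complex.exp_sum, natCast_cpow_eq_exp hm]
  have e1 : ∏ k ∈ Finset.Ico 1 m, (1 + α * s * ((1 / q k : ℝ) : ℂ)) = linProd q (α * s) 1 m :=
    Finset.prod_congr rfl fun k _ => by simp [div_eq_mul_inv]
  have e2 : Complex.exp (α * s * ((∑ k ∈ Finset.Ico 1 m, 1 / q k - Real.log m / α : ℝ) : ℂ)) =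
      Complex.exp (∑ k ∈ Finset.Ico 1 m, α * s * ((1 / q k : ℝ) : ℂ)) *
        Complex.exp (Real.log m * -s) := by
    rw [← Complex.exp_add, ← Finset.mul_sum]
    congr 1
    push_cast
    field_simp
    ring
  rw [e1, e2, mul_div_mul_right _ _ (Complex.exp_ne_zero _)]

/-- The characteristic function of `Z`. -/
lemma integral_exp_Z {r : ℕ → ℕ} (hr : IsRankFunction r) {α : ℝ} (hα : 0 < α)
    (hq : RoughlyLinearSeq (fun k => (r k : ℝ)) α) {Z : (ℕ → ℝ) → ℝ}
    (hZ : ∀ᵐ e ∂iidExp, Tendsto (zPartial r e) atTop (𝓝 (Z e))) (τ : ℝ) {C D : ℂ}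
    (hC : Tendsto (fun m : ℕ => linProd (fun k => (r k : ℝ)) (α * (τ * Complex.I)) 1 m *
      (m : ℂ) ^ (-(τ * Complex.I))) atTop (𝓝 C))
    (hD : Tendsto (fun n : ℕ => linProd (fun k => (k : ℝ) + 1) (α * (τ * Complex.I)) 1 n *
      (n : ℂ) ^ (-(α * (τ * Complex.I)))) atTop (𝓝 D)) (hC0 : C ≠ 0) (hD0 : D ≠ 0) :
    ∫ e, Complex.exp (-α * τ * Z e * Complex.I) ∂iidExp =
      Complex.exp (α * (τ * Complex.I) * ((rho r α + Real.eulerMascheroniConstant / α : ℝ) : ℂ)) / C /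
        (Complex.exp (α * (τ * Complex.I) * ((-1 + Real.eulerMascheroniConstant : ℝ) : ℂ)) / D) := by
  have h1 : Tendsto (fun m => ∫ e, Complex.exp (((-α * τ : ℝ) : ℂ) * zPartial r e m * Complex.I)
      ∂iidExp) atTop (𝓝 (∫ e, Complex.exp (-α * τ * Z e * Complex.I) ∂iidExp)) := by
    refine tendsto_integral_of_dominated_convergence (fun _ => 1) (fun m => ?_)
      (integrable_const _) (fun m => Eventually.of_forall fun e => ?_) ?_
    · have h : Measurable fun x : ℝ => Complex.exp (((-α * τ : ℝ) : ℂ) * x * Complex.I) := by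
        fun_prop
      exact (h.comp (measurable_zPartial r m)).aestronglyMeasurable
    · rw [← Complex.ofReal_mul, Complex.norm_exp_ofReal_mul_I]
    · filter_upwards [hZ] with e he
      refine (Complex.continuous_exp.tendsto _).comp (Tendsto.mul_const _ ?_)
      push_cast
      exact ((Complex.continuous_ofReal.tendsto _).comp he).const_mul _
  refine tendsto_nhds_unique h1 ?_
  set s : ℂ := τ * Complex.I
  -- `φ w` is the characteristic function at `τ` of `-α w (E - 1)` with `E` standard exponential.
  set φ : ℝ → ℂ := fun w => Complex.exp (α * s * w) / (1 + α * s * w)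
  have hA := ((Complex.continuous_exp.tendsto _).comp
    (((Complex.continuous_ofReal.tendsto _).comp hq.tendsto_sum).const_mul (α * s))).div hC hC0
  have hB := ((Complex.continuous_exp.tendsto _).comp
    (((Complex.continuous_ofReal.tendsto _).comp
      roughlyLinearSeq_natCast_add_one.tendsto_sum).const_mul (α * s))).div hD hD0
  rw [tsum_one_div_add_two, div_one] at hB
  -- The product over new values runs up to `r m`, so its limit is taken along `r m → ∞`.
  have hB' := hB.comp (tendsto_rank_atTop hr hq)
  have hne : Complex.exp (α * s * ((-1 + Real.eulerMascheroniConstant : ℝ) : ℂ)) / D ≠ 0 :=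
    div_ne_zero (Complex.exp_ne_zero _) hD0
  refine (((tendsto_add_atTop_iff_nat 1).2 hA).div hB' hne).congr fun m => ?_
  have hden : ∀ w : ℝ, 1 + α * s * w ≠ 0 := fun w h => by
    have := congrArg Complex.re h
    simp [s] at this
  have hφ : ∀ w, φ w ≠ 0 := fun w => div_ne_zero (Complex.exp_ne_zero _) (hden w)
  have e1 := prod_exp_div_linProd (fun k => (r k : ℝ)) hα.ne' s (by omega : 1 ≤ m + 1)
  have e2 := prod_exp_div_linProd (fun k => (k : ℝ) + 1) one_ne_zero (α * s) (hr.one_le m)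
  simp only [Complex.ofReal_one, one_mul] at e2
  have e3 := prod_zCoeff hr φ (by simp [φ]) m
  rw [integral_exp_zPartial]
  simp only [Pi.div_apply, Function.comp_apply]
  rw [← e1, ← e2, div_eq_iff (Finset.prod_ne_zero_iff.2 fun j _ => hφ _)]
  refine e3.symm.trans ?_
  congr 1
  refine Finset.prod_congr rfl fun k _ => ?_
  simp only [φ, s]
  push_cast
  ring_nf

end ZSeries

/-! ### The first repeated value and the half-plane. -/

section FirstRepeated

variable {r : ℕ → ℕ}

/-- Before the first repetition `r k = k + 1`, so at the first repeating index `b` the value is `r b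
= r (b - 1) = b`: index and value coincide, and monotonicity makes `b` the infimum. -/
lemma firstRepeated_cases (hr : IsRankFunction r) :
    (firstRepeated r = ⊤ ∧ ∀ k, r k = k + 1) ∨
      ∃ b, 1 ≤ b ∧ r b = b ∧ (∀ k < b, r k = k + 1) ∧ firstRepeated r = ((b : ℝ) : EReal) := by
  classical
  by_cases h : ∃ k, 1 ≤ k ∧ r k = r (k - 1)
  · right
    obtain ⟨hb1, hb⟩ := Nat.find_spec h
    set b := Nat.find h
    have hlt : ∀ k < b, r k = k + 1 := by
      intro k hk
      induction k with
      | zero => exact hr.1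
      | succ k ih =>
        have h1 := Nat.find_min h hk
        have h2 := ih (by omega)
        have h3 := hr.2 k
        simp only [not_and, Nat.add_sub_cancel] at h1
        have := h1 (by omega)
        omega
    have hrb : r b = b := by
      rw [hb, hlt _ (by omega)]
      omega
    refine ⟨b, hb1, hrb, hlt, le_antisymm ?_ ?_⟩
    · refine (iInf₂_le b ⟨hb1, hb⟩).trans ?_
      rw [hrb]
    · refine le_iInf₂ fun k hk => ?_
      have h1 : b ≤ k := Nat.find_min' h hk
      have h2 := hr.monotone h1
      rw [hrb] at h2
      exact_mod_cast h2
  · left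
    push Not at h
    refine ⟨?_, fun k => ?_⟩
    · rw [firstRepeated, iInf₂_eq_top]
      exact fun k hk => absurd hk.2 (h k hk.1)
    · induction k with
      | zero => exact hr.1
      | succ k ih =>
        have h1 := h (k + 1) (by omega)
        have h3 := hr.2 k
        simp only [Nat.add_sub_cancel] at h1
        omega

lemma neg_coe_div_coe (b α : ℝ) : -(b : EReal) / (α : EReal) = ((-b / α : ℝ) : EReal) := by
  rw [EReal.coe_div, EReal.coe_neg]

lemma exists_admissibleExponent (hr : IsRankFunction r) {α : ℝ} (hα : 0 < α) {s : ℝ}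
    (hs : -firstRepeated r / (α : EReal) < (s : EReal)) :
    ∃ a, AdmissibleExponent r α a s := by
  rcases firstRepeated_cases hr with ⟨-, h⟩ | ⟨b, hb1, -, hlt, hb⟩
  · obtain ⟨a, ha⟩ := exists_nat_gt (-(α * s))
    exact ⟨a, fun k _ => h k, by linarith⟩
  · rw [hb, neg_coe_div_coe, EReal.coe_lt_coe_iff, div_lt_iff₀ hα] at hs
    -- The last index before the repetition is the best start, since there `a + 1 = b`.
    refine ⟨b - 1, fun k hk => hlt k (by omega), ?_⟩
    have : ((b - 1 : ℕ) : ℝ) + 1 = b := by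
      rw [Nat.cast_sub hb1]
      simp
    rw [this, mul_comm]
    exact hs

lemma exists_of_le_neg_firstRepeated_div (hr : IsRankFunction r) {α : ℝ} (hα : 0 < α) {s : ℝ}
    (hs : (s : EReal) ≤ -firstRepeated r / (α : EReal)) :
    ∃ b, 1 ≤ b ∧ r b = b ∧ (∀ k < b, r k = k + 1) ∧ s ≤ -(b : ℝ) / α := by
  rcases firstRepeated_cases hr with ⟨h, -⟩ | ⟨b, hb1, hrb, hlt, hb⟩
  · rw [h, EReal.neg_top, EReal.bot_div_of_pos_ne_top (by exact_mod_cast hα) (EReal.coe_ne_top α)]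
      at hs
    exact absurd (le_bot_iff.1 hs) (EReal.coe_ne_bot s)
  · rw [hb, neg_coe_div_coe, EReal.coe_le_coe_iff] at hs
    exact ⟨b, hb1, hrb, hlt, hs⟩

end FirstRepeated

/-! ### Products near the edge of the half-plane. -/

section Bounds

/-- An upper bound for the products started from `b` that vanishes as `l` tends to `-b`. -/
lemma linProd_mul_rpow_le {q : ℕ → ℝ} {α : ℝ} (hα : 0 < α) (hq : RoughlyLinearSeq q α) {b : ℕ}
    (hq0 : ∀ k, 0 < q k) (hqb : q b = b) (hb : ∀ k ≥ b, (b : ℝ) ≤ q k) :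
    ∃ K : ℝ, 0 < K ∧ ∀ s < 0, -(b : ℝ) < α * s → ∀ m > b,
      linProd q (α * s) b m * (m : ℝ) ^ (-s) ≤ (1 + α * s / b) * K := by
  obtain ⟨B, hB⟩ := hq.tendsto_sum.norm.bddAbove_range
  set S := ∑ k ∈ Finset.Ico 1 (b + 1), 1 / q k
  have hS : 0 ≤ S := Finset.sum_nonneg fun k _ => (one_div_pos.2 (hq0 k)).le
  -- The exponent is `α s (x - S)` with `|α s| < b` and `|x| ≤ B`.
  refine ⟨Real.exp (b * (B + S)), Real.exp_pos _, fun s hs hbs m hm => ?_⟩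
  have hl : α * s < 0 := mul_neg_of_pos_of_neg hα hs
  have hb0 : (0 : ℝ) < b := by linarith
  have hm0 : (0 : ℝ) < m := by exact_mod_cast (Nat.zero_le b).trans_lt hm
  have hnn : ∀ k ≥ b, 0 ≤ 1 + α * s / q k := fun k hk => by
    have h1 := hb k hk
    have : -1 ≤ α * s / q k := by
      rw [le_div_iff₀ (hq0 k)]
      linarith
    linarith
  have h1 : linProd q (α * s) (b + 1) m ≤
      Real.exp (∑ k ∈ Finset.Ico (b + 1) m, α * s * (1 / q k)) := by
    rw [Real.exp_sum, linProd]
    refine Finset.prod_le_prod (fun k hk => ?_) fun k _ => ?_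
    · have := (Finset.mem_Ico.1 hk).1
      exact hnn k (by omega)
    · have := Real.add_one_le_exp (α * s * (1 / q k))
      simp only [RCLike.ofReal_real_eq_id, id]
      rw [mul_one_div] at this
      rw [mul_one_div]
      linarith
  -- Since `q b = b`, the first factor is the one that vanishes as `α s → -b`.
  have h2 : linProd q (α * s) b m = (1 + α * s / b) * linProd q (α * s) (b + 1) m := by
    rw [← linProd_mul q (α * s) b.le_succ hm, linProd_succ q _ le_rfl, linProd_self q _ le_rfl, hqb]
    simp
  have h3 : 0 ≤ 1 + α * s / b := by
    have := hnn b le_rfl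
    rwa [hqb] at this
  rw [h2, mul_assoc]
  refine mul_le_mul_of_nonneg_left ?_ h3
  calc linProd q (α * s) (b + 1) m * (m : ℝ) ^ (-s)
      ≤ Real.exp (∑ k ∈ Finset.Ico (b + 1) m, α * s * (1 / q k)) *
          Real.exp (Real.log m * -s) := by
        rw [Real.rpow_def_of_pos hm0]
        exact mul_le_mul_of_nonneg_right h1 (Real.exp_pos _).le
    _ = Real.exp (α * s * ((∑ k ∈ Finset.Ico 1 m, 1 / q k - Real.log m / α) - S)) := by
        rw [← Real.exp_add, ← Finset.mul_sum,
          ← Finset.sum_Ico_consecutive _ (by omega : 1 ≤ b + 1) (by omega : b + 1 ≤ m)]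
        congr 1
        simp only [S]
        field_simp
        ring
    _ ≤ Real.exp (b * (B + S)) := by
        apply Real.exp_le_exp.2
        have h4 : ‖∑ k ∈ Finset.Ico 1 m, 1 / q k - Real.log m / α‖ ≤ B := hB ⟨m, rfl⟩
        rw [Real.norm_eq_abs, abs_le] at h4
        set x := ∑ k ∈ Finset.Ico 1 m, 1 / q k - Real.log m / α
        nlinarith

/-- A lower bound for the products started from `b`, uniform for `-b < l < 0`. -/
lemma le_linProd_mul_rpow {b : ℕ} {l : ℝ} (hl : l < 0) (hb : -(b : ℝ) < l) {n : ℕ} (hn : b < n) :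
    Real.exp (-(b : ℝ)) ≤ linProd (fun k => (k : ℝ) + 1) l b n * (n : ℝ) ^ (-l) := by
  have hn0 : (0 : ℝ) < n := by exact_mod_cast (Nat.zero_le b).trans_lt hn
  -- Invert `1 + x ≤ exp x` at `x = -l / (k - b + 1)`, using `k + 1 + l > k - b + 1`. The sum of
  -- these exponents is at least `l (1 + log n)`, and `exp (l (1 + log n)) * n ^ (-l) = exp l > exp
  -- (-b)`.
  have hterm : ∀ k ∈ Finset.Ico b n, Real.exp (l * (1 / ((k - b : ℕ) + 1 : ℝ))) ≤
      1 + l / ((k : ℝ) + 1) := by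
    intro k hk
    have hkb : b ≤ k := (Finset.mem_Ico.1 hk).1
    have hkb' : (b : ℝ) ≤ k := by exact_mod_cast hkb
    rw [Nat.cast_sub hkb]
    have h1 : (0 : ℝ) < (k : ℝ) - b + 1 := by linarith
    have h2 : (0 : ℝ) < (k : ℝ) + 1 := by positivity
    have h3 : (0 : ℝ) < (k : ℝ) + 1 + l := by linarith
    have h4 : 1 + l / ((k : ℝ) + 1) = (1 + -l / ((k : ℝ) + 1 + l))⁻¹ := by
      have : 1 + -l / ((k : ℝ) + 1 + l) = ((k : ℝ) + 1) / ((k : ℝ) + 1 + l) := by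
        field_simp
        ring
      rw [this, inv_div]
      field_simp
    have h5 : (0 : ℝ) < 1 + -l / ((k : ℝ) + 1 + l) := by
      have : 0 < -l / ((k : ℝ) + 1 + l) := div_pos (by linarith) h3
      linarith
    rw [h4, le_inv_comm₀ (Real.exp_pos _) h5, ← Real.exp_neg]
    have h6 : -l / ((k : ℝ) + 1 + l) ≤ -(l * (1 / ((k : ℝ) - b + 1))) := by
      rw [mul_one_div, ← neg_div]
      exact div_le_div_of_nonneg_left (by linarith) h1 (by linarith)
    have := Real.add_one_le_exp (-(l * (1 / ((k : ℝ) - b + 1))))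
    linarith
  have h1 : Real.exp (∑ k ∈ Finset.Ico b n, l * (1 / ((k - b : ℕ) + 1 : ℝ))) ≤
      linProd (fun k => (k : ℝ) + 1) l b n := by
    rw [Real.exp_sum, linProd]
    exact Finset.prod_le_prod (fun k _ => (Real.exp_pos _).le) fun k hk => by
      simpa using hterm k hk
  have h2 : ∑ k ∈ Finset.Ico b n, (1 / ((k - b : ℕ) + 1 : ℝ)) ≤ 1 + Real.log n := by
    rw [Finset.sum_Ico_eq_sum_range]
    have h3 := harmonic_le_one_add_log (n - b)
    have h4 : Real.log ((n - b : ℕ) : ℝ) ≤ Real.log n :=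
      Real.log_le_log (by exact_mod_cast (by omega : 0 < n - b)) (by exact_mod_cast Nat.sub_le n b)
    have h5 : ((harmonic (n - b) : ℚ) : ℝ) =
        ∑ k ∈ Finset.range (n - b), (1 / ((b + k - b : ℕ) + 1 : ℝ)) := by
      rw [harmonic]
      push_cast
      simp
    linarith
  calc Real.exp (-(b : ℝ)) ≤ Real.exp (l * (1 + Real.log n)) * (n : ℝ) ^ (-l) := by
        rw [Real.rpow_def_of_pos hn0, ← Real.exp_add]
        apply Real.exp_le_exp.2
        linarith
    _ ≤ _ := by
        refine mul_le_mul_of_nonneg_right (le_trans (Real.exp_le_exp.2 ?_) h1)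
          (Real.rpow_nonneg hn0.le _)
        rw [← Finset.mul_sum]
        exact mul_le_mul_of_nonpos_left h2 hl.le

end Bounds

/-! ### Divergence of moments, law of the limit, analyticity. -/

section Limits

variable {Ω : Type*} [MeasurableSpace Ω] {P : Measure Ω}
  {ℱ : Filtration ℕ (inferInstance : MeasurableSpace Ω)} {M : ℕ → Ω → ℕ} {r : ℕ → ℕ} {α : ℝ}
  {W : Ω → ℝ}

lemma integral_ofReal_cpow {f : Ω → ℝ} (hf : ∀ᵐ ω ∂P, 0 ≤ f ω) (s : ℝ) :
    ∫ ω, (f ω : ℂ) ^ (s : ℂ) ∂P = ((∫ ω, f ω ^ s ∂P : ℝ) : ℂ) := by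
  rw [← integral_complex_ofReal]
  refine integral_congr_ae ?_
  filter_upwards [hf] with ω hω
  rw [Complex.ofReal_cpow hω]

/-- The divergence of the moments. -/
lemma IsHiringChain.tendsto_integral_atTop [IsProbabilityMeasure P] (hM : IsHiringChain r P ℱ M) (hr : IsRankFunction r)
    (hα : 0 < α) (hq : RoughlyLinearSeq (fun k => (r k : ℝ)) α)
    (hW0 : ∀ᵐ ω ∂P, 0 < W ω)
    (hW : ∀ᵐ ω ∂P, Tendsto (fun n : ℕ => (M n ω : ℝ) / (n : ℝ) ^ α) atTop (𝓝 (W ω)))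
    (hinf : ∀ᵐ ω ∂P, Tendsto (fun n => M n ω) atTop atTop)
    {b : ℕ} (hb1 : 1 ≤ b) (hrb : r b = b) (hlt : ∀ k < b, r k = k + 1) {s : ℝ}
    (hs : s ≤ -(b : ℝ) / α) :
    Tendsto (fun n : ℕ => ∫ ω, ((M n ω : ℝ) / (n : ℝ) ^ α) ^ s ∂P) atTop atTop := by
  have hb0 : (0 : ℝ) < b := by exact_mod_cast hb1
  have hr0 : ∀ k, (0 : ℝ) < r k := fun k => by exact_mod_cast hr.one_le k
  have hrbk : ∀ k ≥ b, (b : ℝ) ≤ r k := fun k hk => by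
    have := hr.monotone hk
    rw [hrb] at this
    exact_mod_cast this
  have hadm : ∀ u : ℝ, -(b : ℝ) < α * u → AdmissibleExponent r α (b - 1) u := fun u hu => by
    refine ⟨fun k hk => hlt k (by omega), ?_⟩
    rwa [Nat.cast_sub hb1, Nat.cast_one, sub_add_cancel]
  obtain ⟨K, hK0, hK⟩ := linProd_mul_rpow_le hα hq hr0 (by rw [hrb]) hrbk
  have hlow : ∀ u < 0, -(b : ℝ) < α * u →
      Real.exp (-(b : ℝ)) ≤ (∫ ω, W ω ^ u ∂P) * ((1 + α * u / b) * K) := by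
    intro u hu hbu
    have hpos : ∀ k ≥ b, 0 < 1 + α * u / (r k : ℝ) := fun k hk => by
      have h2 : -1 < α * u / r k := by
        rw [lt_div_iff₀ (hr0 k)]
        linarith [hrbk k hk]
      linarith
    have hpos' : ∀ k ≥ b, 0 < 1 + 1 * (α * u) / ((k : ℝ) + 1) := fun k hk => by
      have hk' : (b : ℝ) ≤ k := by exact_mod_cast hk
      have h2 : -1 < 1 * (α * u) / ((k : ℝ) + 1) := by
        rw [lt_div_iff₀ (by positivity)]
        linarith
      linarith
    obtain ⟨C, hC0, hC⟩ := hq.tendsto_linProd_real hα u b hpos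
    obtain ⟨D, hD0, hD⟩ := roughlyLinearSeq_natCast_add_one.tendsto_linProd_real one_pos (α * u) b
      hpos'
    have hCle : C ≤ (1 + α * u / b) * K :=
      le_of_tendsto hC (by
        filter_upwards [eventually_gt_atTop b] with m hm
        exact hK u hu hbu m hm)
    have hDge : Real.exp (-(b : ℝ)) ≤ D :=
      ge_of_tendsto hD (by
        filter_upwards [eventually_gt_atTop b] with n hn
        simp only [one_mul]
        exact le_linProd_mul_rpow (mul_neg_of_pos_of_neg hα hu) hbu hn)
    have hC' : Tendsto (fun m : ℕ => linProd (fun k => (r k : ℝ)) (α * (u : ℂ)) b m *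
        (m : ℂ) ^ (-(u : ℂ))) atTop (𝓝 (C : ℂ)) := by
      refine ((Complex.continuous_ofReal.tendsto _).comp hC).congr fun m => ?_
      rw [← Complex.ofReal_mul α u, linProd_ofReal]
      simp only [Function.comp_apply, Complex.ofReal_mul (linProd _ _ _ _)]
      rw [Complex.ofReal_cpow (Nat.cast_nonneg m)]
      push_cast
      rfl
    have hD' : Tendsto (fun n : ℕ => linProd (fun k => (k : ℝ) + 1) (α * (u : ℂ)) b n *
        (n : ℂ) ^ (-(α * (u : ℂ)))) atTop (𝓝 (D : ℂ)) := by
      refine ((Complex.continuous_ofReal.tendsto _).comp hD).congr fun n => ?_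
      rw [← Complex.ofReal_mul α u, linProd_ofReal]
      simp only [Function.comp_apply, Complex.ofReal_mul (linProd _ _ _ _), one_mul]
      rw [Complex.ofReal_cpow (Nat.cast_nonneg n)]
      push_cast
      rfl
    -- Integrability uses start `b - 1`, but the exact identity is taken with start `b`, so that the
    -- small factor at `k = b` sits in `C` alone.
    have h := hM.integral_cpow_mul_eq hr hα hq hW0 hW hinf (s := (u : ℂ)) (hadm u hbu) hlt hC' hD'
    rw [integral_ofReal_cpow (hW0.mono fun _ h => h.le)] at h
    have h' : (∫ ω, W ω ^ u ∂P) * C = D := by exact_mod_cast h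
    rw [← h'] at hDge
    refine hDge.trans (mul_le_mul_of_nonneg_left hCle ?_)
    exact integral_nonneg_of_ae (hW0.mono fun ω h => Real.rpow_nonneg h.le _)
  rw [tendsto_atTop]
  intro B
  -- For `α u = -b (1 - δ)` the small factor equals `δ`, so `E W ^ u ≥ exp (-b) / (δ K)`, which is
  -- made larger than `max B 0 + 2`.
  obtain ⟨δ, hδ0, hδ1, hδ⟩ : ∃ δ : ℝ, 0 < δ ∧ δ < 1 ∧
      (max B 0 + 2) * (δ * K) < Real.exp (-(b : ℝ)) := by
    have h1 : Tendsto (fun δ : ℝ => (max B 0 + 2) * (δ * K)) (𝓝[>] 0) (𝓝 ((max B 0 + 2) * (0 * K))) :=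
      (Continuous.tendsto (by fun_prop) 0).mono_left nhdsWithin_le_nhds
    rw [zero_mul, mul_zero] at h1
    obtain ⟨δ, h2, h3, h4⟩ := ((h1.eventually (gt_mem_nhds (Real.exp_pos (-(b : ℝ))))).and
      ((eventually_nhdsWithin_of_eventually_nhds (gt_mem_nhds zero_lt_one)).and
        self_mem_nhdsWithin)).exists
    exact ⟨δ, h4, h3, h2⟩
  set u : ℝ := -(b : ℝ) * (1 - δ) / α
  have hαu : α * u = -(b : ℝ) * (1 - δ) := by
    simp only [u]
    field_simp
  have hu0 : u < 0 := by
    have : α * u < 0 := by rw [hαu]; nlinarith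
    exact neg_of_mul_neg_right this hα.le
  have hbu : -(b : ℝ) < α * u := by rw [hαu]; nlinarith
  have hsu : s ≤ u := by
    refine hs.trans ?_
    rw [div_le_div_iff_of_pos_right hα]
    nlinarith
  have hbig : max B 0 + 2 < ∫ ω, W ω ^ u ∂P := by
    have h1 := hlow u hu0 hbu
    have h2 : 1 + α * u / b = δ := by
      rw [hαu]
      field_simp
      ring
    rw [h2] at h1
    exact lt_of_mul_lt_mul_right (hδ.trans_le h1) (by positivity)
  have hlim : Tendsto (fun n : ℕ => ∫ ω, ((M n ω : ℝ) / (n : ℝ) ^ α) ^ u ∂P) atTop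
      (𝓝 (∫ ω, W ω ^ u ∂P)) := by
    have h := (hM.tendsto_integral_mul hr hα hq hW0 hW hinf (s := (u : ℂ)) (hadm u hbu)
      (tendsto_const_nhds (x := (1 : ℂ)))).2
    simp only [mul_one] at h
    rw [integral_ofReal_cpow (hW0.mono fun _ h => h.le)] at h
    have h2 : ∀ n : ℕ, ∫ ω, (((M n ω : ℝ) / (n : ℝ) ^ α : ℝ) : ℂ) ^ (u : ℂ) ∂P =
        ((∫ ω, ((M n ω : ℝ) / (n : ℝ) ^ α) ^ u ∂P : ℝ) : ℂ) := fun n =>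
      integral_ofReal_cpow (Eventually.of_forall fun ω => by positivity) u
    simp only [h2] at h
    exact (Complex.continuous_re.tendsto _).comp h
  filter_upwards [hlim.eventually (lt_mem_nhds hbig), eventually_ge_atTop 1] with n hn hn1
  have hle : ∫ ω, (((M n ω : ℝ) / (n : ℝ) ^ α) ^ u - 1) ∂P ≤
      ∫ ω, ((M n ω : ℝ) / (n : ℝ) ^ α) ^ s ∂P := by
    refine integral_mono_ae
      (hM.integrable_comp (fun m => ((m : ℝ) / (n : ℝ) ^ α) ^ u - 1) n)
      (hM.integrable_comp (fun m => ((m : ℝ) / (n : ℝ) ^ α) ^ s) n) ?_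
    filter_upwards [hM.ae_one_le hr] with ω hω
    have hm : (0 : ℝ) < M n ω := by exact_mod_cast hω n hn1
    have hn' : (0 : ℝ) < n := by exact_mod_cast hn1
    have hy : 0 < (M n ω : ℝ) / (n : ℝ) ^ α := by positivity
    set y := (M n ω : ℝ) / (n : ℝ) ^ α
    show y ^ u - 1 ≤ y ^ s
    -- For `y ≤ 1`, `s ≤ u` gives `y ^ u ≤ y ^ s`; for `y ≥ 1`, `u < 0` gives `y ^ u ≤ 1`.
    rcases le_total y 1 with h | h
    · have := Real.rpow_le_rpow_of_exponent_ge hy h hsu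
      linarith
    · have h1 := Real.rpow_le_one_of_one_le_of_nonpos h hu0.le
      have h2 := Real.rpow_nonneg hy.le s
      linarith
  rw [integral_sub (hM.integrable_comp (fun m => ((m : ℝ) / (n : ℝ) ^ α) ^ u) n)
    (integrable_const _)] at hle
  simp only [integral_const, probReal_univ, smul_eq_mul, mul_one] at hle
  linarith [le_max_left B 0]

/-- The representation of the limit by the series `Z`. -/
lemma IsHiringChain.identDistrib [IsProbabilityMeasure P] (hM : IsHiringChain r P ℱ M) (hr : IsRankFunction r)
    (hα : 0 < α) (hq : RoughlyLinearSeq (fun k => (r k : ℝ)) α) (hWm : Measurable W)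
    (hW0 : ∀ᵐ ω ∂P, 0 < W ω)
    (hW : ∀ᵐ ω ∂P, Tendsto (fun n : ℕ => (M n ω : ℝ) / (n : ℝ) ^ α) atTop (𝓝 (W ω)))
    (hinf : ∀ᵐ ω ∂P, Tendsto (fun n => M n ω) atTop atTop)
    {Z : (ℕ → ℝ) → ℝ} (hZm : Measurable Z)
    (hZ : ∀ᵐ e ∂iidExp, Tendsto (zPartial r e) atTop (𝓝 (Z e))) :
    IdentDistrib W (fun e =>
      Real.exp ((α - 1) * Real.eulerMascheroniConstant - α * rho r α - α) * Real.exp (-α * Z e))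
      P iidExp := by
  set κ := (α - 1) * Real.eulerMascheroniConstant - α * rho r α - α
  have hlogm : Measurable fun ω => Real.log (W ω) := Real.measurable_log.comp hWm
  have hVm : Measurable fun e => κ + -α * Z e := (hZm.const_mul (-α)).const_add κ
  have hlog : IdentDistrib (fun ω => Real.log (W ω)) (fun e => κ + -α * Z e) P iidExp := by
    refine ⟨hlogm.aemeasurable, hVm.aemeasurable, ?_⟩
    have : IsProbabilityMeasure (P.map fun ω => Real.log (W ω)) :=
      Measure.isProbabilityMeasure_map hlogm.aemeasurable
    have : IsProbabilityMeasure (iidExp.map fun e => κ + -α * Z e) :=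
      Measure.isProbabilityMeasure_map hVm.aemeasurable
    refine Measure.ext_of_charFun (funext fun τ => ?_)
    rw [charFun_apply_real, charFun_apply_real, integral_map hlogm.aemeasurable (by fun_prop),
      integral_map hVm.aemeasurable (by fun_prop)]
    -- On the imaginary axis every factor has real part `1`, so no product vanishes.
    have hne : ∀ x : ℝ, 1 + α * (τ * Complex.I) / (x : ℂ) ≠ 0 := fun x h => by
      have h1 : α * (τ * Complex.I) / (x : ℂ) = ((α * τ / x : ℝ) : ℂ) * Complex.I := by
        push_cast
        ring
      rw [h1] at h
      simpa using congrArg Complex.re h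
    obtain ⟨C, hC, hC0⟩ := hq.tendsto_linProd hα (τ * Complex.I) 1
    obtain ⟨D, hD, hD0⟩ :=
      roughlyLinearSeq_natCast_add_one.tendsto_linProd one_pos (α * (τ * Complex.I)) 1
    simp only [Complex.ofReal_one, one_mul] at hD hD0
    replace hC0 := hC0 fun k _ => hne _
    replace hD0 := hD0 fun k _ => hne _
    have hZchar := integral_exp_Z hr hα hq hZ τ hC hD hC0 hD0
    have hWchar := hM.integral_cpow_mul_eq hr hα hq hW0 hW hinf (s := τ * Complex.I)
      (admissibleExponent_zero (α := α) hr (by simp)) (b := 1)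
      (fun k hk => by
        obtain rfl : k = 0 := by omega
        exact hr.1) hC hD
    have e1 : ∫ ω, Complex.exp (τ * Real.log (W ω) * Complex.I) ∂P =
        ∫ ω, (W ω : ℂ) ^ (τ * Complex.I) ∂P := by
      refine integral_congr_ae ?_
      filter_upwards [hW0] with ω hω
      rw [ofReal_cpow_eq_exp hω]
      congr 1
      ring
    have e2 : ∀ e, Complex.exp (τ * ((κ + -α * Z e : ℝ) : ℂ) * Complex.I) =
        Complex.exp (τ * κ * Complex.I) * Complex.exp (-α * τ * Z e * Complex.I) := fun e => by
      rw [← Complex.exp_add]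
      congr 1
      push_cast
      ring
    rw [e1]
    simp only [e2]
    rw [integral_const_mul, hZchar, eq_div_of_mul_eq hC0 hWchar]
    have hα' : (α : ℂ) ≠ 0 := by exact_mod_cast hα.ne'
    -- The constant `κ` is determined by `α (γ - 1) = κ + α ρ + γ`.
    have e3 : Complex.exp (α * (τ * Complex.I) *
          ((-1 + Real.eulerMascheroniConstant : ℝ) : ℂ)) =
        Complex.exp (τ * κ * Complex.I) * Complex.exp (α * (τ * Complex.I) *
          ((rho r α + Real.eulerMascheroniConstant / α : ℝ) : ℂ)) := by
      rw [← Complex.exp_add]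
      congr 1
      simp only [κ]
      push_cast
      field_simp
      ring
    rw [e3]
    have h1 := Complex.exp_ne_zero (τ * κ * Complex.I)
    have h2 := Complex.exp_ne_zero (α * (τ * Complex.I) *
          ((rho r α + Real.eulerMascheroniConstant / α : ℝ) : ℂ))
    field_simp
  have h1 : IdentDistrib (fun ω => Real.exp (Real.log (W ω)))
      (fun e => Real.exp (κ + -α * Z e)) P iidExp := hlog.comp Real.measurable_exp
  have h2 : IdentDistrib W (fun ω => Real.exp (Real.log (W ω))) P P :=
    IdentDistrib.of_ae_eq hWm.aemeasurable (hW0.mono fun ω h => (Real.exp_log h).symm)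
  simpa only [Real.exp_add] using h2.trans h1

/-- The analyticity of the moments. -/
lemma differentiableOn_integral_cpow (hW0 : ∀ᵐ ω ∂P, 0 < W ω)
    (hint : ∀ s ∈ halfPlane r α, Integrable (fun ω => (W ω : ℂ) ^ s) P) :
    DifferentiableOn ℂ (fun s : ℂ => ∫ ω, (W ω : ℂ) ^ s ∂P) (halfPlane r α) := by
  -- `W ^ s = exp (s log W)`, and a complex moment generating function is analytic over the interior
  -- of its integrability set.
  have h : ∀ s : ℂ, ∫ ω, (W ω : ℂ) ^ s ∂P = complexMGF (fun ω => Real.log (W ω)) P s := by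
    intro s
    rw [complexMGF]
    refine integral_congr_ae ?_
    filter_upwards [hW0] with ω hω
    rw [ofReal_cpow_eq_exp hω, mul_comm]
  simp only [h]
  refine differentiableOn_complexMGF.mono fun s hs => ?_
  have hsub : {x : ℝ | -firstRepeated r / (α : EReal) < (x : EReal)} ⊆
      integrableExpSet (fun ω => Real.log (W ω)) P := by
    intro x hx
    have h1 := (hint (x : ℂ) (by simpa [halfPlane] using hx)).norm
    refine h1.congr ?_
    filter_upwards [hW0] with ω hω
    rw [Complex.norm_cpow_eq_rpow_re_of_pos hω, Real.rpow_def_of_pos hω, Complex.ofReal_re,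
      mul_comm]
  exact interior_maximal hsub
    (isOpen_lt continuous_const continuous_coe_real_ereal) hs

end Limits

end Hiring

theorem mainTheorem8 {Ω : Type*} [MeasurableSpace Ω] (P : Measure Ω) [IsProbabilityMeasure P]
    (ν : Measure ℝ) [NullSingletonClass ν] (X : ℕ → Ω → ℝ) (hX : ∀ i, Measurable (X i))
    (hlaw : ∀ i, P.map (X i) = ν) (hindep : iIndepFun X P)
    (r : ℕ → ℕ) (hr : Hiring.IsRankFunction r)
    (α : ℝ) (hα0 : 0 < α) (hα1 : α ≤ 1) (hlin : Hiring.RoughlyLinear r α) :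
    ∃ W : Ω → ℝ, Measurable W ∧ (∀ᵐ ω ∂P, 0 < W ω) ∧
      -- `W` is the almost sure limit of `M_n / n ^ α`
      (∀ᵐ ω ∂P, Tendsto
        (fun n : ℕ => (Hiring.numAccepted r (fun i => X i ω) n : ℝ) / (n : ℝ) ^ α)
        atTop (𝓝 (W ω))) ∧
      -- the representation of `W` through the random series `Z`
      (∃ Z : (ℕ → ℝ) → ℝ, Measurable Z ∧
        (∀ᵐ e ∂Hiring.iidExp, Tendsto (Hiring.zPartial r e) atTop (𝓝 (Z e))) ∧
        IdentDistrib W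
          (fun e => Real.exp ((α - 1) * Real.eulerMascheroniConstant - α * Hiring.rho r α - α)
            * Real.exp (-α * Z e)) P Hiring.iidExp) ∧
      -- convergence of the moments, with a finite limit, in the half-plane
      (∀ s ∈ Hiring.halfPlane r α,
        Integrable (fun ω => (W ω : ℂ) ^ s) P ∧
        Tendsto
          (fun n : ℕ => (∫ ω, (Hiring.numAccepted r (fun i => X i ω) n : ℂ) ^ s ∂P)
            / (n : ℂ) ^ ((α : ℂ) * s))
          atTop (𝓝 (∫ ω, (W ω : ℂ) ^ s ∂P))) ∧
      -- the limit is analytic in the half-plane, and it is given by the product formula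
      -- (outside the removable singularities of that formula)
      DifferentiableOn ℂ (fun s : ℂ => ∫ ω, (W ω : ℂ) ^ s ∂P) (Hiring.halfPlane r α) ∧
      (∀ s ∈ Hiring.halfPlane r α, (∀ k : ℕ, 1 ≤ k → s ≠ -(k : ℂ)) →
        (∀ k : ℕ, 1 ≤ k → s * α ≠ -(r k : ℂ)) →
        Multipliable (fun k : ℕ =>
          (1 + s / ((k + 1 : ℕ) : ℂ)) / (1 + s * α / (r (k + 1) : ℂ))) ∧
        ∫ ω, (W ω : ℂ) ^ s ∂P =
          Complex.Gamma (s + 1) / Complex.Gamma (s * α + 2) *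
            ∏' k : ℕ, (1 + s / ((k + 1 : ℕ) : ℂ)) / (1 + s * α / (r (k + 1) : ℂ))) ∧
      -- divergence for the remaining real exponents
      (∀ s : ℝ, (s : EReal) ≤ -Hiring.firstRepeated r / (α : EReal) →
        Tendsto
          (fun n : ℕ => (∫ ω, (Hiring.numAccepted r (fun i => X i ω) n : ℝ) ^ s ∂P)
            / (n : ℝ) ^ (α * s))
          atTop atTop) := by
  have hq : Hiring.RoughlyLinearSeq (fun k => (r k : ℝ)) α := summable_abs_iff.1 hlin
  have hM := Hiring.isHiringChain_hires (P := P) hX hlaw hindep hr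
  set M : ℕ → Ω → ℕ := fun n ω => Hiring.hires r (Hiring.relRank fun i => X i ω) n with hMdef
  have hnum : ∀ n ω, Hiring.numAccepted r (fun i => X i ω) n = M n ω :=
    fun n ω => Hiring.numAccepted_eq_hires r hr _ n
  obtain ⟨W, hWm, hW0, hW, hinf⟩ := hM.exists_limit hr hα0 hq
  obtain ⟨Z, hZm, hZ⟩ := Hiring.exists_tendsto_zPartial hq
  have hlim : ∀ s ∈ Hiring.halfPlane r α, ∃ a, Hiring.AdmissibleExponent r α a s.re :=
    fun s hs => Hiring.exists_admissibleExponent hr hα0 hs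
  have hint : ∀ s ∈ Hiring.halfPlane r α, Integrable (fun ω => (W ω : ℂ) ^ s) P := fun s hs => by
    obtain ⟨a, ha⟩ := hlim s hs
    simpa using (hM.tendsto_integral_mul hr hα0 hq hW0 hW hinf ha
      (tendsto_const_nhds (x := (1 : ℂ)))).1
  simp only [hnum]
  refine ⟨W, hWm, hW0, hW, ⟨Z, hZm, hZ, hM.identDistrib hr hα0 hq hWm hW0 hW hinf hZm hZ⟩,
    fun s hs => ⟨hint s hs, ?_⟩, Hiring.differentiableOn_integral_cpow hW0 hint,
    fun s hs hsk hsr => ?_, fun s hs => ?_⟩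
  · obtain ⟨a, ha⟩ := hlim s hs
    have h := (hM.tendsto_integral_mul hr hα0 hq hW0 hW hinf ha
      (tendsto_const_nhds (x := (1 : ℂ)))).2
    simp only [mul_one] at h
    refine h.congr' ?_
    filter_upwards [eventually_ge_atTop 1] with n hn
    rw [div_eq_mul_inv, ← Complex.cpow_neg, ← integral_mul_const]
    refine integral_congr_ae ?_
    filter_upwards [hM.ae_one_le hr] with ω hω
    exact Hiring.div_rpow_cpow (hω n hn) hn α s
  · obtain ⟨a, ha⟩ := hlim s hs
    have hne : ∀ k ≥ 1, 1 + (α : ℂ) * s / (((r k : ℝ)) : ℂ) ≠ 0 := fun k hk h => by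
      have hk0 : (r k : ℂ) ≠ 0 := by
        have := hr.one_le k
        exact_mod_cast (by omega : r k ≠ 0)
      refine hsr k hk ?_
      rw [Complex.ofReal_natCast] at h
      field_simp at h
      linear_combination h
    obtain ⟨C, hC, hC0⟩ := hq.tendsto_linProd hα0 s 1
    -- A pole would mean `α s = -(m + 2)`, and `m + 2` is a value of `r` at some `k ≥ 1`.
    have hpole : ∀ m : ℕ, (α : ℂ) * s + 2 ≠ -(m : ℂ) := fun m h => by
      obtain ⟨k, hk, hkm⟩ := Hiring.exists_rank_eq hr (Hiring.tendsto_rank_atTop hr hq)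
        (by omega : 2 ≤ m + 2)
      refine hsr k hk ?_
      rw [hkm]
      push_cast
      linear_combination h
    obtain ⟨hmul, hprod⟩ := Hiring.multipliable_and_tprod hr hα0 hlin hsk hsr hC (hC0 hne)
    refine ⟨hmul, ?_⟩
    -- The start `1` is always allowed since `r 0 = 1`; the index `a` only secures integrability.
    have h := hM.integral_cpow_mul_eq hr hα0 hq hW0 hW hinf ha (b := 1)
      (fun k hk => by
        obtain rfl : k = 0 := by omega
        exact hr.1) hC (Hiring.tendsto_linProd_natCast_add_one hpole)
    have hΓ : Complex.Gamma (s + 1) ≠ 0 := Complex.Gamma_ne_zero fun m h => hsk (m + 1) (by omega) (by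
      push_cast
      linear_combination h)
    rw [hprod, eq_div_of_mul_eq (hC0 hne) h, mul_comm s (α : ℂ)]
    field_simp
  · obtain ⟨b, hb1, hrb, hlt, hsb⟩ := Hiring.exists_of_le_neg_firstRepeated_div hr hα0 hs
    refine (hM.tendsto_integral_atTop hr hα0 hq hW0 hW hinf hb1 hrb hlt hsb).congr fun n => ?_
    rw [← integral_div]
    refine integral_congr_ae (Eventually.of_forall fun ω => ?_)
    simp only
    rw [Real.div_rpow (Nat.cast_nonneg _) (by positivity), ← Real.rpow_mul (Nat.cast_nonneg n)]
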